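/- Let $\alpha^+,\lambda^+,\alpha^-,\lambda^->0$ and $\beta^+,\beta^-\in[0,1)$. For $\alpha,\lambda>0$, $\beta\in[0,1)$ let $\mathrm{TS}(\alpha,\beta,\lambda)$ be the infinitely divisible distribution on $\mathbb{R}$ with characteristic function $$z\mapsto\exp\Big(\int_0^\infty (e^{izx}-1)\,\frac{\alpha}{x^{1+\beta}}e^{-\lambda x}\,dx\Big),$$ and let $\mathrm{TS}(\alpha^+,\beta^+,\lambda^+;\alpha^-,\beta^-,\lambda^-)$ be the convolution of $\mathrm{TS}(\alpha^+,\beta^+,\lambda^+)$ with the image of $\mathrm{TS}(\alpha^-,\beta^-,\lambda^-)$ under $x\mapsto -x$. Let $X=(X_t)_{t\ge0}$ be a tempered stable process with these parameters, that is, a real Lévy process with $X_1\sim\mathrm{TS}(\alpha^+,\beta^+,\lambda^+;\alpha^-,\beta^-,\lambda^-)$. Then $X_1$ is square integrable with positive variance. Put $\mu=\mathbb{E}[X_1]$, $\sigma^2=\mathrm{Var}[X_1]$ with $\sigma>0$, and let $W$ be a Brownian motion (with drift) such that $W_1\sim N(\mu,\sigma^2)$. Let $c$ be the constant of the Berry–Esseen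 theorem, i.e. the least $C$ such that $$\sup_{x\in\mathbb{R}}\Big|\mathbb{P}\Big(\frac{Y_1+\dots+Y_n}{s\sqrt n}\le x\Big)-\Phi(x)\Big|\le C\,\frac{\mathbb{E}|Y_1|^3}{s^3\sqrt n}$$ for all $n\ge1$ and all i.i.d. centred random variables $Y_1,\dots,Y_n$ with $\mathbb{E}|Y_1|^3<\infty$ and $s^2=\mathbb{E}[Y_1^2]>0$, where $\Phi$ is the standard normal distribution function. Writing $G_Z$ for the distribution function of $Z$, for all $t>0$ $$\sup_{x\in\mathbb{R}}|G_{X_t}(x)-G_{W_t}(x)|\le\frac{32c}{\sqrt t}\bigg[(1-\beta^+)(2-\beta^+)\frac{(1-\beta^-)\mu/\sigma^3+\lambda^- /\sigma}{\lambda^+((1-\beta^-)\lambda^++(1-\beta^+)\lambda^-)}+(1-\beta^-)(2-\beta^-)\frac{(\beta^+-1)\mu/\sigma^3+\lambda^+/\sigma}{\lambda^-((1-\beta^-)\lambda^++(1-\beta^+)\lambda^-)}\bigg].$$ The right-hand side, and hence also the left-hand side, tends to $0$ as $t\to\infty$. -/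

import Mathlib

open MeasureTheory ProbabilityTheory Filter Topology
open scoped NNReal ENNReal

namespace TemperedStable

noncomputable section

/-- `η` is infinitely divisible: for each `n ≥ 1` it is the law of a sum of `n` i.i.d. variables. -/
def IsInfinitelyDivisible (η : Measure ℝ) : Prop :=
  IsProbabilityMeasure η ∧ ∀ n : ℕ, 0 < n → ∃ ν : Measure ℝ, IsProbabilityMeasure ν ∧
    (Measure.pi fun _ : Fin n => ν).map (fun y => ∑ i, y i) = η

/-- The measure `α x ^ (-1 - β) e ^ (-lam x) 1_{x > 0} dx`. -/
def oneSidedLevyMeasure (α β lam : ℝ) : Measure ℝ :=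
  volume.withDensity fun x =>
    ENNReal.ofReal (if 0 < x then α / x ^ (1 + β) * Real.exp (-lam * x) else 0)

/-- `η` is the one-sided tempered stable distribution `TS(α, β, lam)`. -/
def IsOneSidedTS (α β lam : ℝ) (η : Measure ℝ) : Prop :=
  IsInfinitelyDivisible η ∧
    ∀ z : ℝ, charFun η z =
      Complex.exp (∫ x : ℝ, (Complex.exp (Complex.I * z * x) - 1) ∂(oneSidedLevyMeasure α β lam))

/-- `η` is the tempered stable distribution `TS(αp, βp, lp; αm, βm, lm)`: the convolution of
`TS(αp, βp, lp)` with the reflection of `TS(αm, βm, lm)`. -/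
def IsTS (αp βp lp αm βm lm : ℝ) (η : Measure ℝ) : Prop :=
  ∃ ηp ν : Measure ℝ, IsOneSidedTS αp βp lp ηp ∧ IsOneSidedTS αm βm lm ν ∧
    η = ηp.conv (ν.map fun x => -x)

/-- A real-valued Lévy process. -/
structure IsLevyProcess {Ω : Type*} [MeasurableSpace Ω] (X : ℝ≥0 → Ω → ℝ) (P : Measure Ω) :
    Prop where
  measurable : ∀ t, Measurable (X t)
  zero : ∀ᵐ ω ∂P, X 0 ω = 0
  indep : HasIndepIncrements X P
  stationary : ∀ s h : ℝ≥0, P.map (fun ω => X (s + h) ω - X s ω) = P.map (X h)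
  stochCont : ∀ t, TendstoInMeasure P X (𝓝 t) (X t)
  cadlag : ∀ᵐ ω ∂P, ∀ t : ℝ≥0,
    ContinuousWithinAt (fun s => X s ω) (Set.Ici t) t ∧
      ∃ l : ℝ, Tendsto (fun s => X s ω) (𝓝[<] t) (𝓝 l)

/-- `X` is a tempered stable process: the Lévy process associated to the corresponding tempered
stable distribution, which is the law of `X 1`. -/
def IsTSProcess {Ω : Type*} [MeasurableSpace Ω] (αp βp lp αm βm lm : ℝ)
    (X : ℝ≥0 → Ω → ℝ) (P : Measure Ω) : Prop :=
  IsLevyProcess X P ∧ IsTS αp βp lp αm βm lm (P.map (X 1))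

/-- `W` is a Brownian motion with some drift and some variance: `W t = m t + s B t` with a standard
Brownian motion `B`. -/
def IsBrownianMotion {Ω : Type*} [MeasurableSpace Ω] (W : ℝ≥0 → Ω → ℝ) (P : Measure Ω) : Prop :=
  ∃ (m s : ℝ) (B : ℝ≥0 → Ω → ℝ), IsBrownianReal B P ∧ ∀ t ω, W t ω = m * t + s * B t ω

/-- `C` is admissible in the Berry-Esseen inequality for normalized sums of i.i.d. centred random
variables with finite third absolute moment (with law `ν`). -/
def IsBerryEsseenBound (C : ℝ) : Prop :=
  ∀ ν : Measure ℝ, IsProbabilityMeasure ν → Integrable (fun x => |x| ^ 3) ν →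
    ∫ x, x ∂ν = 0 → 0 < ∫ x, x ^ 2 ∂ν → ∀ n : ℕ, 0 < n → ∀ x : ℝ,
      |(Measure.pi fun _ : Fin n => ν).real
            {y | (∑ i, y i) / (√(∫ u, u ^ 2 ∂ν) * √(n : ℝ)) ≤ x} -
          cdf (gaussianReal 0 1) x| ≤
        C * (∫ u, |u| ^ 3 ∂ν) / (√(∫ u, u ^ 2 ∂ν) ^ 3 * √(n : ℝ))

/-- The constant of the Berry-Esseen theorem: the least admissible one. -/
def berryEsseenConstant : ℝ := sInf {C : ℝ | IsBerryEsseenBound C}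

/-- The Kolmogorov distance between two probability measures on the line. -/
def kolmogorovDist (η ν : Measure ℝ) : ℝ := ⨆ x : ℝ, |cdf η x - cdf ν x|

/-- The right-hand side of the estimate, as a function of the time `t`. -/
def rateBound (βp lp βm lm μ σ t : ℝ) : ℝ :=
  32 * berryEsseenConstant / √t *
    ((1 - βp) * (2 - βp) * (((1 - βm) * μ / σ ^ 3 + lm / σ) /
        (lp * ((1 - βm) * lp + (1 - βp) * lm))) +
      (1 - βm) * (2 - βm) * (((βp - 1) * μ / σ ^ 3 + lp / σ) /
        (lm * ((1 - βm) * lp + (1 - βp) * lm))))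

end

end TemperedStable

/-!
# Normal approximation of tempered stable processes

The marginal `X t` of a tempered stable process is a sum of `n` independent increments over
intervals of length `t / n`, so the Berry-Esseen inequality bounds its distance to the normal law by
`c n E|Y|³ / (σ³ t ^ (3 / 2))`, where `Y` is a centred increment. As `n` grows, `n E|Y|³` is at most
a fixed multiple of `t (κ₃⁺ + κ₃⁻)`, with `κₖ` the `k`-th moments of the one-sided Lévy measures,
that is, the cumulants of the one-sided laws. The Gamma function gives `λ κₖ₊₁ = (k - β) κₖ` on
each side, so the third cumulants can be expressed by `μ = κ₁⁺ - κ₁⁻` and `σ² = κ₂⁺ + κ₂⁻`, and the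
rate of the theorem is `32 c (κ₃⁺ + κ₃⁻) / (σ³ √t)` (`rateBound_eq`).

*The Berry-Esseen theorem.* The constant `c` is an infimum, which is meaningful only because some
constant is admissible. This is `kolmogorovDist_sumLaw_le`, proved by Lindeberg's method and
induction on the number `n` of summands. In the presence of an extra normal component of variance
`ε²`, with `ε` proportional to the third moment `ρ`, the summands are exchanged for normal ones, one
at a time. When one of `k + 1` remaining summands is exchanged and the normal components add up to
a law of variance `V`, `abs_cdf_exchange_le` bounds the cost of this exchange by a multiple of
`ρ (Dₖ V ^ (-3 / 2) + (k + V) ^ (-3 / 2))`, where `Dₖ` is the Kolmogorov distance for `k` summands: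
by Taylor's formula only third derivatives of the smoothed distribution functions matter, and those
of a difference of two laws are controlled by its supremum. Removing the smoothing costs a multiple
of `ε / √n` (`kolmogorovDist_le_of_smoothed`). The resulting recursion is a contraction once `ε / ρ`
is large.

*Moments of small increments.* The modulus of the characteristic function of the `N`-th convolution
root is the `N`-th root of the modulus, so symmetrized roots are determined without choosing a
branch of the logarithm. Their second and fourth moments are read off the characteristic function near
the origin (`integral_sq_of_cos_eq`, `integral_pow_four_le_of_cos_eq`). For each one-sided law,
interpolation between these two bounds the third absolute moment of the symmetrized root by
`4 κ₃ / N` for large `N` (`IsOneSidedTS.exists_root`), because `κ₂ κ₄ ≤ 2 κ₃²`; the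
symmetrized increment of `X` over an interval of length `1 / N` is the independent sum of the two
one-sided ones, and Jensen's inequality passes to the centred increment (`IsTS.moments_of_root`).

This settles rational times, `IsTSProcess.abs_cdf_sub_le_of_rat`; stochastic continuity extends the
estimate to all times, `IsLevyProcess.abs_cdf_sub_le_of_tendsto`.
-/

namespace TemperedStable

/-! ### Laws of i.i.d. sums and distribution functions of convolutions -/

/-- The law of the sum of `n` independent variables with common law `ν`. -/
noncomputable def sumLaw (ν : Measure ℝ) (n : ℕ) : Measure ℝ :=
  (Measure.pi fun _ : Fin n => ν).map (fun y => ∑ i, y i)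

instance isProbabilityMeasure_sumLaw (ν : Measure ℝ) [IsProbabilityMeasure ν] (n : ℕ) :
    IsProbabilityMeasure (sumLaw ν n) :=
  Measure.isProbabilityMeasure_map (by fun_prop)

lemma charFun_sumLaw (ν : Measure ℝ) [IsProbabilityMeasure ν] (n : ℕ) (z : ℝ) :
    charFun (sumLaw ν n) z = charFun ν z ^ n := by
  rw [sumLaw, charFun_map_sum_pi_eq_prod]
  simp

lemma sumLaw_zero (ν : Measure ℝ) [IsProbabilityMeasure ν] : sumLaw ν 0 = Measure.dirac 0 := by
  apply Measure.ext_of_charFun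
  ext z
  simp [charFun_sumLaw]

lemma sumLaw_succ (ν : Measure ℝ) [IsProbabilityMeasure ν] (n : ℕ) :
    sumLaw ν (n + 1) = (sumLaw ν n).conv ν := by
  apply Measure.ext_of_charFun
  ext z
  rw [charFun_conv, charFun_sumLaw, charFun_sumLaw, pow_succ]

lemma cdf_conv (η ν : Measure ℝ) [IsProbabilityMeasure η] [IsProbabilityMeasure ν] (z : ℝ) :
    cdf (η.conv ν) z = ∫ x, cdf ν (z - x) ∂η := by
  have h : ∀ z, cdf (η.conv ν) z = ∫ x, (Set.Iic z).indicator (fun _ => (1 : ℝ)) x ∂(η.conv ν) := by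
    intro z
    rw [cdf_eq_real, integral_indicator measurableSet_Iic]
    simp
  rw [h, integral_conv]
  · refine integral_congr_ae (.of_forall fun x => ?_)
    simp only
    have : (fun y => (Set.Iic z).indicator (fun _ => (1 : ℝ)) (x + y))
        = (Set.Iic (z - x)).indicator (fun _ => (1 : ℝ)) := by
      ext y
      simp only [Set.indicator, Set.mem_Iic]
      congr 1
      simp only [eq_iff_iff]
      constructor <;> intro <;> linarith
    rw [this, integral_indicator measurableSet_Iic, cdf_eq_real]
    simp
  · exact (integrable_const (1 : ℝ)).indicator measurableSet_Iic

lemma measurable_cdf_sub (ν : Measure ℝ) (z : ℝ) : Measurable fun x => cdf ν (z - x) :=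
  (monotone_cdf ν).measurable.comp (by fun_prop)

lemma integrable_cdf_sub (η ν : Measure ℝ) [IsProbabilityMeasure η] (z : ℝ) :
    Integrable (fun x => cdf ν (z - x)) η := by
  refine Integrable.of_bound (measurable_cdf_sub ν z).aestronglyMeasurable 1
    (.of_forall fun x => ?_)
  rw [Real.norm_eq_abs, abs_of_nonneg (cdf_nonneg _ _)]
  exact cdf_le_one _ _

lemma abs_cdf_sub_cdf_le_one (η ν : Measure ℝ) (x : ℝ) : |cdf η x - cdf ν x| ≤ 1 := by
  rw [abs_le]
  constructor <;> linarith [cdf_nonneg η x, cdf_le_one η x, cdf_nonneg ν x, cdf_le_one ν x]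

lemma abs_cdf_sub_le_kolmogorovDist (η ν : Measure ℝ) (x : ℝ) :
    |cdf η x - cdf ν x| ≤ kolmogorovDist η ν :=
  le_ciSup (f := fun x => |cdf η x - cdf ν x|)
    ⟨1, by rintro _ ⟨y, rfl⟩; exact abs_cdf_sub_cdf_le_one η ν y⟩ x

lemma kolmogorovDist_nonneg (η ν : Measure ℝ) : 0 ≤ kolmogorovDist η ν :=
  Real.iSup_nonneg fun _ => abs_nonneg _

/-- Functions decaying at `+∞` with integrable derivative: two laws at Kolmogorov distance `D`
integrate them to values at distance at most `D` times the total variation. -/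
lemma abs_integral_sub_le_of_cdf {η η' : Measure ℝ} [IsProbabilityMeasure η]
    [IsProbabilityMeasure η'] {w w' : ℝ → ℝ} (hw : ∀ x, HasDerivAt w (w' x) x)
    (hw' : Integrable w') (hlim : Tendsto w atTop (𝓝 0)) {D : ℝ}
    (hD : ∀ x, |cdf η x - cdf η' x| ≤ D) :
    |∫ x, w x ∂η - ∫ x, w x ∂η'| ≤ D * ∫ x, |w' x| := by
  have key : ∀ (ξ : Measure ℝ) [IsProbabilityMeasure ξ],
      ∫ x, w x ∂ξ = -∫ v, w' v * cdf ξ v := by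
    intro ξ _
    have h1 : ∀ s, w s = -∫ v, (Set.Ici s).indicator w' v := by
      intro s
      rw [integral_indicator measurableSet_Ici, integral_Ici_eq_integral_Ioi,
        integral_Ioi_of_hasDerivAt_of_tendsto (hw s).continuousAt.continuousWithinAt
          (fun x _ => hw x) hw'.integrableOn hlim]
      simp
    have h2 : ∫ s, (∫ v, (Set.Ici s).indicator w' v) ∂ξ
        = ∫ v, (∫ s, (Set.Ici s).indicator w' v ∂ξ) := by
      apply integral_integral_swap
      have : (Function.uncurry fun (s v : ℝ) => (Set.Ici s).indicator w' v)
          = {p : ℝ × ℝ | p.1 ≤ p.2}.indicator (fun p => w' p.2) := by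
        ext ⟨s, v⟩
        simp [Set.indicator, Function.uncurry]
      rw [this]
      exact (hw'.comp_snd ξ).indicator (measurableSet_le measurable_fst measurable_snd)
    rw [integral_congr_ae (.of_forall h1), integral_neg, h2]
    congr 1
    refine integral_congr_ae (.of_forall fun v => ?_)
    simp only
    have : (fun s => (Set.Ici s).indicator w' v) = (Set.Iic v).indicator (fun _ => w' v) := by
      ext s
      simp [Set.indicator]
    rw [this, integral_indicator measurableSet_Iic, cdf_eq_real]
    simp [mul_comm]
  have hint : ∀ (ξ : Measure ℝ) [IsProbabilityMeasure ξ], Integrable fun v => w' v * cdf ξ v := by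
    intro ξ _
    refine hw'.mul_bdd (c := 1) (monotone_cdf ξ).measurable.aestronglyMeasurable
      (.of_forall fun x => ?_)
    rw [Real.norm_eq_abs, abs_of_nonneg (cdf_nonneg _ _)]
    exact cdf_le_one _ _
  rw [key η, key η', neg_sub_neg, ← integral_sub (hint _) (hint _), ← integral_const_mul]
  refine (abs_integral_le_integral_abs).trans
    (integral_mono ((hint _).sub (hint _)).abs (hw'.abs.const_mul D) fun v => ?_)
  simp only
  rw [← mul_sub, abs_mul, mul_comm, abs_sub_comm]
  exact mul_le_mul_of_nonneg_right (hD v) (abs_nonneg _)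

/-! ### Derivatives of the centred normal distribution function -/

section Gaussian

variable {V : ℝ≥0}

lemma hasDerivAt_gaussianPDFReal (hV : V ≠ 0) (x : ℝ) :
    HasDerivAt (gaussianPDFReal 0 V) (-(x / V) * gaussianPDFReal 0 V x) x := by
  have hV' : (V : ℝ) ≠ 0 := by exact_mod_cast hV
  have h1 : HasDerivAt (fun x : ℝ => -(x - 0) ^ 2 / (2 * V)) (-(x / V)) x := by
    have := (((hasDerivAt_id x).sub_const 0).pow 2).neg.div_const (2 * (V : ℝ))
    refine this.congr_deriv ?_
    simp
    field_simp
  have := h1.exp.const_mul (√(2 * Real.pi * V))⁻¹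
  rw [gaussianPDFReal_def]
  refine this.congr_deriv ?_
  simp only
  ring

/-- The second derivative of the centred normal density of variance `V`. -/
noncomputable def gaussianPDFDeriv2 (V : ℝ≥0) (x : ℝ) : ℝ :=
  ((x / V) ^ 2 - 1 / V) * gaussianPDFReal 0 V x

/-- The third derivative of the centred normal density of variance `V`. -/
noncomputable def gaussianPDFDeriv3 (V : ℝ≥0) (x : ℝ) : ℝ :=
  (3 * x / V ^ 2 - (x / V) ^ 3) * gaussianPDFReal 0 V x

lemma hasDerivAt_gaussianPDFReal_deriv (hV : V ≠ 0) (x : ℝ) :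
    HasDerivAt (fun x => -(x / V) * gaussianPDFReal 0 V x) (gaussianPDFDeriv2 V x) x := by
  have := (((hasDerivAt_id x).div_const (V : ℝ)).neg).mul (hasDerivAt_gaussianPDFReal hV x)
  refine this.congr_deriv ?_
  simp [gaussianPDFDeriv2]
  ring

lemma hasDerivAt_gaussianPDFDeriv2 (hV : V ≠ 0) (x : ℝ) :
    HasDerivAt (gaussianPDFDeriv2 V) (gaussianPDFDeriv3 V x) x := by
  have := ((((hasDerivAt_id x).div_const (V : ℝ)).pow 2).sub_const (1 / (V : ℝ))).mul
    (hasDerivAt_gaussianPDFReal hV x)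
  refine this.congr_deriv ?_
  simp [gaussianPDFDeriv3]
  ring

lemma two_le_sqrt_two_pi : 2 ≤ √(2 * Real.pi) := by
  apply Real.le_sqrt_of_sq_le
  nlinarith [Real.pi_gt_three]

/-- In the scale-free variable `y = |x| / √V`, the density is at most `exp (-y² / 2) / (2 √V)`. -/
lemma gaussianPDFReal_le_exp (hV : V ≠ 0) (x : ℝ) :
    gaussianPDFReal 0 V x ≤ (2 * √V)⁻¹ * Real.exp (-(|x| / √V) ^ 2 / 2) := by
  have hV' : (0 : ℝ) < V := by exact_mod_cast pos_iff_ne_zero.mpr hV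
  have h : -(x - 0) ^ 2 / (2 * V) = -(|x| / √V) ^ 2 / 2 := by
    rw [div_pow, sq_abs, Real.sq_sqrt hV'.le]
    field_simp
    ring
  rw [gaussianPDFReal, h, Real.sqrt_mul (by positivity)]
  gcongr
  exact two_le_sqrt_two_pi

lemma mul_exp_neg_sq_le {a y : ℝ} (h : a ≤ 1 + y ^ 2 / 2) : a * Real.exp (-y ^ 2 / 2) ≤ 1 := by
  rw [neg_div, Real.exp_neg, ← div_eq_mul_inv, div_le_one (Real.exp_pos _)]
  linarith [Real.add_one_le_exp (y ^ 2 / 2)]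

lemma gaussianPDFReal_le (hV : V ≠ 0) (x : ℝ) : gaussianPDFReal 0 V x ≤ (√V)⁻¹ := by
  have hV' : (0 : ℝ) < V := by exact_mod_cast pos_iff_ne_zero.mpr hV
  have hs : 0 < √(V : ℝ) := Real.sqrt_pos.mpr hV'
  refine (gaussianPDFReal_le_exp hV x).trans ?_
  have := mul_exp_neg_sq_le (a := 1) (y := |x| / √V) (by nlinarith [sq_nonneg (|x| / √V)])
  rw [mul_inv]
  have h2 : 0 < (√(V : ℝ))⁻¹ := by positivity
  nlinarith

lemma abs_gaussianPDFReal_deriv_le (hV : V ≠ 0) (x : ℝ) :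
    |-(x / V) * gaussianPDFReal 0 V x| ≤ (V : ℝ)⁻¹ := by
  have hV' : (0 : ℝ) < V := by exact_mod_cast pos_iff_ne_zero.mpr hV
  have hs : 0 < √(V : ℝ) := Real.sqrt_pos.mpr hV'
  have hs2 : √(V : ℝ) ^ 2 = V := Real.sq_sqrt hV'.le
  rw [abs_mul, abs_neg, abs_div, abs_of_pos hV', abs_of_nonneg (gaussianPDFReal_nonneg _ _ _)]
  have h1 := gaussianPDFReal_le_exp hV x
  have h2 := mul_exp_neg_sq_le (a := |x| / √V) (y := |x| / √V)
    (by nlinarith [sq_nonneg (|x| / √V - 1)])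
  calc |x| / V * gaussianPDFReal 0 V x
      ≤ |x| / V * ((2 * √V)⁻¹ * Real.exp (-(|x| / √V) ^ 2 / 2)) := by gcongr
    _ = (2 * V : ℝ)⁻¹ * (|x| / √V * Real.exp (-(|x| / √V) ^ 2 / 2)) := by field_simp
    _ ≤ (2 * V : ℝ)⁻¹ * 1 := by gcongr
    _ ≤ (V : ℝ)⁻¹ := by
      rw [mul_one, mul_inv]
      have : 0 < (V : ℝ)⁻¹ := by positivity
      linarith

lemma abs_gaussianPDFDeriv2_le (hV : V ≠ 0) (x : ℝ) :
    |gaussianPDFDeriv2 V x| ≤ (√V ^ 3)⁻¹ := by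
  have hV' : (0 : ℝ) < V := by exact_mod_cast pos_iff_ne_zero.mpr hV
  have hs : 0 < √(V : ℝ) := Real.sqrt_pos.mpr hV'
  have hs2 : √(V : ℝ) ^ 2 = V := Real.sq_sqrt hV'.le
  have hV2 : (V : ℝ) ≠ 0 := hV'.ne'
  rw [gaussianPDFDeriv2, abs_mul, abs_of_nonneg (gaussianPDFReal_nonneg _ _ _)]
  have h0 : |(x / V) ^ 2 - 1 / (V : ℝ)| ≤ (2 / V : ℝ) * (1 / 2 + (|x| / √V) ^ 2 / 2) := by
    have e : (x / V) ^ 2 = (|x| / √V) ^ 2 / V := by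
      rw [div_pow, div_pow, sq_abs, hs2]; field_simp
    have : (2 / V : ℝ) * (1 / 2 + (|x| / √V) ^ 2 / 2) = 1 / V + (|x| / √V) ^ 2 / V := by
      field_simp
    rw [e, this]
    have p1 : 0 ≤ 1 / (V : ℝ) := by positivity
    have p2 : 0 ≤ (|x| / √V) ^ 2 / (V : ℝ) := by positivity
    rw [abs_le]
    constructor <;> linarith
  have h1 := gaussianPDFReal_le_exp hV x
  have h2 := mul_exp_neg_sq_le (a := 1 / 2 + (|x| / √V) ^ 2 / 2) (y := |x| / √V) (by linarith)
  calc |(x / V) ^ 2 - 1 / (V : ℝ)| * gaussianPDFReal 0 V x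
      ≤ ((2 / V : ℝ) * (1 / 2 + (|x| / √V) ^ 2 / 2)) *
        ((2 * √V)⁻¹ * Real.exp (-(|x| / √V) ^ 2 / 2)) := by
        gcongr
        exact gaussianPDFReal_nonneg _ _ _
    _ = (V * √V : ℝ)⁻¹ * ((1 / 2 + (|x| / √V) ^ 2 / 2) *
        Real.exp (-(|x| / √V) ^ 2 / 2)) := by field_simp
    _ ≤ (V * √V : ℝ)⁻¹ * 1 := by gcongr
    _ = (√V ^ 3)⁻¹ := by rw [mul_one, pow_succ, hs2]

/-- Half of the Gaussian decay absorbs polynomial factors; the other half is a normal density of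
twice the variance. -/
lemma gaussianPDFReal_le_exp_mul_gaussianPDFReal_two_mul (hV : V ≠ 0) (x : ℝ) :
    gaussianPDFReal 0 V x ≤
      2 * Real.exp (-(|x| / √V) ^ 2 / 4) * gaussianPDFReal 0 (2 * V) x := by
  have hV' : (0 : ℝ) < V := by exact_mod_cast pos_iff_ne_zero.mpr hV
  have hs : 0 < √(V : ℝ) := Real.sqrt_pos.mpr hV'
  have hs2 : √(V : ℝ) ^ 2 = V := Real.sq_sqrt hV'.le
  have e : Real.exp (-(x - 0) ^ 2 / (2 * V)) =
      Real.exp (-(|x| / √V) ^ 2 / 4) * Real.exp (-(x - 0) ^ 2 / (2 * (2 * V))) := by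
    rw [← Real.exp_add]
    congr 1
    rw [div_pow, sq_abs, hs2]
    field_simp
    ring
  simp only [gaussianPDFReal, NNReal.coe_mul, NNReal.coe_ofNat]
  rw [e]
  have h2 : √(2 * Real.pi * (2 * V)) ≤ 2 * √(2 * Real.pi * V) := by
    rw [show (2 : ℝ) * √(2 * Real.pi * V) = √(2 ^ 2 * (2 * Real.pi * V)) by
      rw [Real.sqrt_mul (x := 2 ^ 2) (by positivity), Real.sqrt_sq (by norm_num)]]
    apply Real.sqrt_le_sqrt
    nlinarith [mul_pos Real.pi_pos hV']
  have h3 : (√(2 * Real.pi * V))⁻¹ ≤ 2 * (√(2 * Real.pi * (2 * V)))⁻¹ := by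
    have p1 : 0 < √(2 * Real.pi * V) := Real.sqrt_pos.mpr (by positivity)
    have p2 : 0 < √(2 * Real.pi * (2 * V)) := Real.sqrt_pos.mpr (by positivity)
    rw [← div_eq_mul_inv, inv_le_iff_one_le_mul₀ p1, div_mul_eq_mul_div, one_le_div p2]
    exact h2
  calc _ ≤ (2 * (√(2 * Real.pi * (2 * V)))⁻¹) * (Real.exp (-(|x| / √V) ^ 2 / 4) *
      Real.exp (-(x - 0) ^ 2 / (2 * (2 * V)))) := by gcongr
    _ = _ := by ring

lemma abs_gaussianPDFDeriv3_le (hV : V ≠ 0) (x : ℝ) :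
    |gaussianPDFDeriv3 V x| ≤ 32 * (√V ^ 3)⁻¹ * gaussianPDFReal 0 (2 * V) x := by
  have hV' : (0 : ℝ) < V := by exact_mod_cast pos_iff_ne_zero.mpr hV
  have hs : 0 < √(V : ℝ) := Real.sqrt_pos.mpr hV'
  have hs2 : √(V : ℝ) ^ 2 = V := Real.sq_sqrt hV'.le
  rw [gaussianPDFDeriv3, abs_mul, abs_of_nonneg (gaussianPDFReal_nonneg _ _ _)]
  set y := |x| / √V with hy
  have hy0 : 0 ≤ y := by positivity
  have hx : |x| = y * √V := by rw [hy]; field_simp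
  have h0 : |3 * x / (V : ℝ) ^ 2 - (x / V) ^ 3| ≤ (√V ^ 3)⁻¹ * (3 * y + y ^ 3) := by
    refine (abs_sub _ _).trans (le_of_eq ?_)
    rw [abs_div, abs_mul, abs_pow, abs_pow, abs_div, hx, abs_of_pos hV', Nat.abs_ofNat]
    have e4 : (V : ℝ) ^ 2 = √V ^ 4 := by nth_rw 1 [← hs2]; ring
    have e2 : y * √V / V = y / √V := by nth_rw 2 [← hs2]; field_simp
    rw [e4, e2]
    field_simp
  have hexp : (3 * y + y ^ 3) * Real.exp (-y ^ 2 / 4) ≤ 16 := by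
    rw [neg_div, Real.exp_neg, ← div_eq_mul_inv, div_le_iff₀ (Real.exp_pos _)]
    have := Real.quadratic_le_exp_of_nonneg (x := y ^ 2 / 4) (by positivity)
    nlinarith [sq_nonneg (y - 1), mul_nonneg hy0 (sq_nonneg (y - 1)), sq_nonneg (y ^ 2 - y)]
  calc |3 * x / (V : ℝ) ^ 2 - (x / V) ^ 3| * gaussianPDFReal 0 V x
      ≤ ((√V ^ 3)⁻¹ * (3 * y + y ^ 3)) *
        (2 * Real.exp (-y ^ 2 / 4) * gaussianPDFReal 0 (2 * V) x) := by
        gcongr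
        · exact gaussianPDFReal_nonneg _ _ _
        · exact gaussianPDFReal_le_exp_mul_gaussianPDFReal_two_mul hV x
    _ = (√V ^ 3)⁻¹ * ((3 * y + y ^ 3) * Real.exp (-y ^ 2 / 4)) * 2 *
        gaussianPDFReal 0 (2 * V) x := by ring
    _ ≤ (√V ^ 3)⁻¹ * 16 * 2 * gaussianPDFReal 0 (2 * V) x := by
        gcongr
        exact gaussianPDFReal_nonneg _ _ _
    _ = _ := by ring

lemma continuous_gaussianPDFReal (V : ℝ≥0) : Continuous (gaussianPDFReal 0 V) := by
  rw [gaussianPDFReal_def]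
  fun_prop

lemma continuous_gaussianPDFDeriv2 (V : ℝ≥0) : Continuous (gaussianPDFDeriv2 V) := by
  have := continuous_gaussianPDFReal V
  unfold gaussianPDFDeriv2
  fun_prop

lemma continuous_gaussianPDFDeriv3 (V : ℝ≥0) : Continuous (gaussianPDFDeriv3 V) := by
  have := continuous_gaussianPDFReal V
  unfold gaussianPDFDeriv3
  fun_prop

lemma integrable_gaussianPDFDeriv3 (hV : V ≠ 0) : Integrable (gaussianPDFDeriv3 V) :=
  ((integrable_gaussianPDFReal 0 (2 * V)).const_mul (32 * (√V ^ 3)⁻¹)).mono'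
    (continuous_gaussianPDFDeriv3 V).aestronglyMeasurable
    (.of_forall fun x => by
      rw [Real.norm_eq_abs]; exact abs_gaussianPDFDeriv3_le hV x)

lemma integral_abs_gaussianPDFDeriv3_le (hV : V ≠ 0) :
    ∫ x, |gaussianPDFDeriv3 V x| ≤ 32 * (√V ^ 3)⁻¹ := by
  calc ∫ x, |gaussianPDFDeriv3 V x|
      ≤ ∫ x, 32 * (√V ^ 3)⁻¹ * gaussianPDFReal 0 (2 * V) x :=
        integral_mono (integrable_gaussianPDFDeriv3 hV).abs
          ((integrable_gaussianPDFReal 0 (2 * V)).const_mul _) (abs_gaussianPDFDeriv3_le hV)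
    _ = _ := by rw [integral_const_mul, integral_gaussianPDFReal_eq_one 0 (by positivity), mul_one]

lemma tendsto_gaussianPDFDeriv2_atBot (hV : V ≠ 0) :
    Tendsto (gaussianPDFDeriv2 V) atBot (𝓝 0) := by
  have hV' : (0 : ℝ) < V := by exact_mod_cast pos_iff_ne_zero.mpr hV
  have hI : Integrable (gaussianPDFDeriv2 V) := by
    refine ((integrable_gaussianPDFReal 0 (2 * V)).const_mul (8 / V : ℝ)).mono'
      (continuous_gaussianPDFDeriv2 V).aestronglyMeasurable (.of_forall fun x => ?_)
    have hs2 : √(V : ℝ) ^ 2 = V := Real.sq_sqrt hV'.le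
    rw [Real.norm_eq_abs, gaussianPDFDeriv2, abs_mul,
      abs_of_nonneg (gaussianPDFReal_nonneg _ _ _)]
    have h0 : |(x / V) ^ 2 - 1 / (V : ℝ)| ≤ (1 / V : ℝ) * (1 + (|x| / √V) ^ 2) := by
      have e : (x / V) ^ 2 = (1 / V : ℝ) * (|x| / √V) ^ 2 := by
        rw [div_pow, div_pow, sq_abs, hs2]; field_simp
      rw [e, mul_add, mul_one, add_comm]
      refine (abs_sub _ _).trans (le_of_eq ?_)
      rw [abs_of_nonneg (a := 1 / (V : ℝ) * (|x| / √V) ^ 2) (by positivity),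
        abs_of_nonneg (a := 1 / (V : ℝ)) (by positivity)]
    have h1 : (1 + (|x| / √V) ^ 2) * Real.exp (-(|x| / √V) ^ 2 / 4) ≤ 4 := by
      rw [neg_div, Real.exp_neg, ← div_eq_mul_inv, div_le_iff₀ (Real.exp_pos _)]
      linarith [Real.add_one_le_exp ((|x| / √(V : ℝ)) ^ 2 / 4)]
    calc |(x / V) ^ 2 - 1 / (V : ℝ)| * gaussianPDFReal 0 V x
        ≤ ((1 / V : ℝ) * (1 + (|x| / √V) ^ 2)) *
          (2 * Real.exp (-(|x| / √V) ^ 2 / 4) * gaussianPDFReal 0 (2 * V) x) := by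
          gcongr
          · exact gaussianPDFReal_nonneg _ _ _
          · exact gaussianPDFReal_le_exp_mul_gaussianPDFReal_two_mul hV x
      _ = (1 / V : ℝ) * ((1 + (|x| / √V) ^ 2) * Real.exp (-(|x| / √V) ^ 2 / 4)) * 2 *
          gaussianPDFReal 0 (2 * V) x := by ring
      _ ≤ (1 / V : ℝ) * 4 * 2 * gaussianPDFReal 0 (2 * V) x := by
          gcongr
          exact gaussianPDFReal_nonneg _ _ _
      _ = _ := by ring
  exact tendsto_zero_of_hasDerivAt_of_integrableOn_Iic (a := 0)
    (fun x _ => hasDerivAt_gaussianPDFDeriv2 hV x)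
    (integrable_gaussianPDFDeriv3 hV).integrableOn hI.integrableOn

lemma hasDerivAt_cdf_gaussianReal (hV : V ≠ 0) (x : ℝ) :
    HasDerivAt (cdf (gaussianReal 0 V)) (gaussianPDFReal 0 V x) x := by
  have h : ∀ x, cdf (gaussianReal 0 V) x = ∫ u in Set.Iic x, gaussianPDFReal 0 V u := by
    intro x
    rw [cdf_eq_real, Measure.real, gaussianReal_apply_eq_integral 0 hV, ENNReal.toReal_ofReal]
    exact integral_nonneg fun _ => gaussianPDFReal_nonneg _ _ _
  have h2 : ∀ y, cdf (gaussianReal 0 V) y =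
      cdf (gaussianReal 0 V) 0 + ∫ u in (0 : ℝ)..y, gaussianPDFReal 0 V u := by
    intro y
    rw [h, h, ← intervalIntegral.integral_Iic_sub_Iic
      (integrable_gaussianPDFReal 0 V).integrableOn (integrable_gaussianPDFReal 0 V).integrableOn]
    ring
  rw [show (cdf (gaussianReal 0 V) : ℝ → ℝ) = fun y => cdf (gaussianReal 0 V) 0 +
    ∫ u in (0 : ℝ)..y, gaussianPDFReal 0 V u from funext h2]
  exact ((continuous_gaussianPDFReal V).integral_hasStrictDerivAt 0 x).hasDerivAt.const_add _

lemma cdf_gaussianReal_sub_le (hV : V ≠ 0) {x y : ℝ} (hxy : x ≤ y) :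
    cdf (gaussianReal 0 V) y - cdf (gaussianReal 0 V) x ≤ (√V)⁻¹ * (y - x) := by
  have hmono : Monotone fun x => (√V)⁻¹ * x - cdf (gaussianReal 0 V) x := by
    refine monotone_of_deriv_nonneg (fun z => ?_) fun z => ?_
    · exact (((hasDerivAt_id z).const_mul _).sub
        (hasDerivAt_cdf_gaussianReal hV z)).differentiableAt
    · have := ((hasDerivAt_id z).const_mul (√(V : ℝ))⁻¹).sub (hasDerivAt_cdf_gaussianReal hV z)
      erw [this.deriv]
      linarith [gaussianPDFReal_le hV z]
  have := hmono hxy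
  simp only at this
  linarith

end Gaussian

/-! ### Exchanging a summand for a Gaussian one -/

/-- Taylor's formula of order three, with a non-optimal constant. -/
lemma abs_sub_taylor_le {G G1 G2 G3 : ℝ → ℝ} (h0 : ∀ x, HasDerivAt G (G1 x) x)
    (h1 : ∀ x, HasDerivAt G1 (G2 x) x) (h2 : ∀ x, HasDerivAt G2 (G3 x) x) {M : ℝ}
    (hM : ∀ x, |G3 x| ≤ M) (y : ℝ) :
    |G y - (G 0 + G1 0 * y + G2 0 * (y ^ 2 / 2))| ≤ M * |y| ^ 3 := by
  -- three mean value inequalities on the interval between `0` and `y`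
  have mv : ∀ (f f' : ℝ → ℝ) (C : ℝ), (∀ x, HasDerivAt f (f' x) x) → f 0 = 0 →
      (∀ x, |x| ≤ |y| → |f' x| ≤ C) → ∀ x, |x| ≤ |y| → |f x| ≤ C * |y| := by
    intro f f' C hf hf0 hC x hx
    have hC0 : 0 ≤ C := (abs_nonneg _).trans (hC x hx)
    have := (convex_Icc (-|y|) |y|).norm_image_sub_le_of_norm_hasDerivWithin_le
      (f := f) (f' := f') (C := C) (fun u _ => (hf u).hasDerivWithinAt)
      (fun u hu => hC u (abs_le.mpr hu)) (x := 0) (y := x)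
      ⟨by simp, by simp⟩ (abs_le.mp hx)
    rw [hf0, sub_zero, sub_zero] at this
    exact this.trans (by gcongr; exact hx)
  have a2 := mv (fun x => G2 x - G2 0) G3 M (fun x => (h2 x).sub_const _) (by simp)
    (fun x _ => hM x)
  have a1 := mv (fun x => G1 x - G1 0 - G2 0 * x) (fun x => G2 x - G2 0) (M * |y|)
    (fun x => (((h1 x).sub_const _).sub ((hasDerivAt_id x).const_mul (G2 0))).congr_deriv
      (by simp)) (by simp) a2
  have a0 := mv (fun x => G x - G 0 - G1 0 * x - G2 0 * (x ^ 2 / 2))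
    (fun x => G1 x - G1 0 - G2 0 * x) (M * |y| * |y|)
    (fun x => ((((h0 x).sub_const _).sub ((hasDerivAt_id x).const_mul (G1 0))).sub
      ((((hasDerivAt_id x).pow 2).div_const 2).const_mul (G2 0))).congr_deriv
      (by simp)) (by simp) a1 y le_rfl
  calc _ = |G y - G 0 - G1 0 * y - G2 0 * (y ^ 2 / 2)| := by congr 1; ring
    _ ≤ _ := a0
    _ = _ := by ring

/-- Two laws with the same first two moments integrate a smooth function to values whose
difference is controlled by the third derivative and the third absolute moments. -/
lemma abs_integral_sub_le_third_moment {G G1 G2 G3 : ℝ → ℝ}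
    (h0 : ∀ x, HasDerivAt G (G1 x) x)
    (h1 : ∀ x, HasDerivAt G1 (G2 x) x) (h2 : ∀ x, HasDerivAt G2 (G3 x) x) {M : ℝ}
    (hM : ∀ x, |G3 x| ≤ M) {ν γ : Measure ℝ} [IsProbabilityMeasure ν] [IsProbabilityMeasure γ]
    (hν : MemLp id 3 ν) (hγ : MemLp id 3 γ) (hGν : Integrable G ν) (hGγ : Integrable G γ)
    (e1 : ∫ x, x ∂ν = ∫ x, x ∂γ) (e2 : ∫ x, x ^ 2 ∂ν = ∫ x, x ^ 2 ∂γ) :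
    |∫ x, G x ∂ν - ∫ x, G x ∂γ| ≤ M * (∫ x, |x| ^ 3 ∂ν + ∫ x, |x| ^ 3 ∂γ) := by
  have key : ∀ (ξ : Measure ℝ) [IsProbabilityMeasure ξ], MemLp id 3 ξ → Integrable G ξ →
      |∫ x, G x ∂ξ - (G 0 + G1 0 * ∫ x, x ∂ξ + G2 0 * ((∫ x, x ^ 2 ∂ξ) / 2))| ≤
        M * ∫ x, |x| ^ 3 ∂ξ := by
    intro ξ _ hξ hG
    have i1 : Integrable (fun x : ℝ => x) ξ := hξ.integrable (by norm_num)
    have i2 : Integrable (fun x : ℝ => x ^ 2) ξ := (hξ.mono_exponent (by norm_num)).integrable_sq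
    have i3 : Integrable (fun x : ℝ => |x| ^ 3) ξ := by
      have := hξ.integrable_norm_pow (p := 3) (by norm_num)
      simpa using this
    have e : ∫ x, G x ∂ξ - (G 0 + G1 0 * ∫ x, x ∂ξ + G2 0 * ((∫ x, x ^ 2 ∂ξ) / 2)) =
        ∫ x, (G x - (G 0 + G1 0 * x + G2 0 * (x ^ 2 / 2))) ∂ξ := by
      have j0 : Integrable (fun x : ℝ => G 0 + G1 0 * x) ξ :=
        (integrable_const _).add (i1.const_mul _)
      have j1 : Integrable (fun x : ℝ => G2 0 * (x ^ 2 / 2)) ξ := (i2.div_const 2).const_mul _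
      have j2 : Integrable (fun x : ℝ => G 0 + G1 0 * x + G2 0 * (x ^ 2 / 2)) ξ := j0.add j1
      rw [integral_sub hG j2,
        integral_add j0 j1,
        integral_add (integrable_const _) (i1.const_mul _), integral_const_mul,
        integral_const_mul, integral_div]
      simp
    rw [e, ← integral_const_mul]
    refine abs_integral_le_integral_abs.trans (integral_mono_of_nonneg
      (.of_forall fun _ => abs_nonneg _) (i3.const_mul M) (.of_forall fun x => ?_))
    exact abs_sub_taylor_le h0 h1 h2 hM x
  have k1 := key ν hν hGν
  have k2 := key γ hγ hGγ
  rw [e1, e2] at k1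
  rw [abs_le] at k1 k2 ⊢
  constructor <;> linarith [k1.1, k1.2, k2.1, k2.2]

/-- Differentiation under the integral sign against a probability measure. -/
lemma hasDerivAt_integral_comp_sub {f f' : ℝ → ℝ} (hf : ∀ x, HasDerivAt f (f' x) x)
    (hf' : Continuous f') {C C' : ℝ} (hC : ∀ x, |f x| ≤ C) (hC' : ∀ x, |f' x| ≤ C')
    (η : Measure ℝ) [IsProbabilityMeasure η] (z y : ℝ) :
    HasDerivAt (fun y => ∫ s, f (z - y - s) ∂η) (-∫ s, f' (z - y - s) ∂η) y := by
  have hcont : Continuous f := continuous_iff_continuousAt.mpr fun x => (hf x).continuousAt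
  have := hasDerivAt_integral_of_dominated_loc_of_deriv_le (μ := η) (x₀ := y) (s := Set.univ)
    (F := fun y s => f (z - y - s)) (F' := fun y s => -f' (z - y - s)) (bound := fun _ => C')
    univ_mem (.of_forall fun u => (by fun_prop : Continuous _).aestronglyMeasurable)
    (Integrable.of_bound (by fun_prop : Continuous _).aestronglyMeasurable C
      (.of_forall fun s => hC _))
    (by fun_prop : Continuous _).aestronglyMeasurable
    (.of_forall fun s u _ => by simpa using hC' _) (integrable_const _)
    (.of_forall fun s u _ => by
      have h := (hf (z - u - s)).comp u (((hasDerivAt_id u).const_sub z).sub_const s)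
      simpa [Function.comp_def] using h)
  simpa [integral_neg] using this.2

/-- The map `y ↦ cdf (η ∗ N(0, V)) (z - y)` is three times differentiable, with the derivatives
obtained from those of the normal distribution function. -/
lemma hasDerivAt_cdf_conv_gaussianReal {V : ℝ≥0} (hV : V ≠ 0) (η : Measure ℝ)
    [IsProbabilityMeasure η] (z y : ℝ) :
    HasDerivAt (fun y => cdf (η.conv (gaussianReal 0 V)) (z - y))
        (-∫ s, gaussianPDFReal 0 V (z - y - s) ∂η) y ∧
      HasDerivAt (fun y => -∫ s, gaussianPDFReal 0 V (z - y - s) ∂η)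
        (∫ s, -((z - y - s) / V) * gaussianPDFReal 0 V (z - y - s) ∂η) y ∧
      HasDerivAt (fun y => ∫ s, -((z - y - s) / V) * gaussianPDFReal 0 V (z - y - s) ∂η)
        (-∫ s, gaussianPDFDeriv2 V (z - y - s) ∂η) y := by
  have c0 := continuous_gaussianPDFReal V
  refine ⟨?_, ?_, ?_⟩
  · simp_rw [cdf_conv]
    refine hasDerivAt_integral_comp_sub (hasDerivAt_cdf_gaussianReal hV) c0 (C := 1)
      (C' := (√V)⁻¹) (fun x => ?_) (fun x => ?_) η z y
    · rw [abs_of_nonneg (cdf_nonneg _ _)]; exact cdf_le_one _ _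
    · rw [abs_of_nonneg (gaussianPDFReal_nonneg _ _ _)]; exact gaussianPDFReal_le hV x
  · have := (hasDerivAt_integral_comp_sub (hasDerivAt_gaussianPDFReal hV) (by fun_prop)
      (C := (√V)⁻¹) (C' := (V : ℝ)⁻¹) (fun x => ?_) (abs_gaussianPDFReal_deriv_le hV) η z y).neg
    · rw [neg_neg] at this
      exact this
    · rw [abs_of_nonneg (gaussianPDFReal_nonneg _ _ _)]; exact gaussianPDFReal_le hV x
  · exact hasDerivAt_integral_comp_sub (hasDerivAt_gaussianPDFReal_deriv hV)
      (continuous_gaussianPDFDeriv2 V) (abs_gaussianPDFReal_deriv_le hV)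
      (abs_gaussianPDFDeriv2_le hV) η z y

/-- A summand of law `ν` may be exchanged for a standard normal one. With a further normal
component of variance `V`, the cost is governed by the distance `D` between `η` and the normal law
of variance `k`, plus the cost of the exchange when `η` is replaced by that normal law. -/
lemma abs_cdf_exchange_le {ν : Measure ℝ} [IsProbabilityMeasure ν] (hν : MemLp id 3 ν)
    (m1 : ∫ x, x ∂ν = 0) (m2 : ∫ x, x ^ 2 ∂ν = 1)
    {η : Measure ℝ} [IsProbabilityMeasure η] {k V : ℝ≥0} (hV : V ≠ 0) {D : ℝ}
    (hD : ∀ x, |cdf η x - cdf (gaussianReal 0 k) x| ≤ D) (z : ℝ) :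
    |cdf ((η.conv (gaussianReal 0 V)).conv ν) z -
        cdf ((η.conv (gaussianReal 0 V)).conv (gaussianReal 0 1)) z| ≤
      (32 * D * (√V ^ 3)⁻¹ + (√(k + V : ℝ≥0) ^ 3)⁻¹) *
        (∫ x, |x| ^ 3 ∂ν + ∫ x, |x| ^ 3 ∂(gaussianReal 0 1)) := by
  have hγ : MemLp id 3 (gaussianReal 0 1) := memLp_id_gaussianReal 3
  have g1 : ∫ x, x ∂ν = ∫ x, x ∂(gaussianReal 0 1) := by rw [m1, integral_id_gaussianReal]
  have g2 : ∫ x, x ^ 2 ∂ν = ∫ x, x ^ 2 ∂(gaussianReal 0 1) := by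
    have h := variance_fun_id_gaussianReal (μ := 0) (v := 1)
    rw [variance_of_integral_eq_zero (by fun_prop) integral_id_gaussianReal] at h
    rw [m2, h]
    simp
  have comm : ∀ (ξ : Measure ℝ) [IsProbabilityMeasure ξ],
      cdf ((η.conv (gaussianReal 0 V)).conv ξ) z =
        ∫ x, cdf (η.conv (gaussianReal 0 V)) (z - x) ∂ξ := by
    intro ξ _
    rw [Measure.conv_comm, cdf_conv]
  have hkV : k + V ≠ 0 := by positivity
  -- the difference of the two smoothed distribution functions
  have hd : ∀ y, _ := fun y => hasDerivAt_cdf_conv_gaussianReal hV η z y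
  have hd' : ∀ y, _ := fun y => hasDerivAt_cdf_conv_gaussianReal hV (gaussianReal 0 k) z y
  have hG := abs_integral_sub_le_third_moment
    (fun y => (hd y).1.sub (hd' y).1) (fun y => (hd y).2.1.sub (hd' y).2.1)
    (fun y => (hd y).2.2.sub (hd' y).2.2) (M := 32 * D * (√V ^ 3)⁻¹) (fun y => by
      rw [neg_sub_neg, abs_sub_comm]
      refine (abs_integral_sub_le_of_cdf (w := fun s => gaussianPDFDeriv2 V (z - y - s))
        (w' := fun s => -gaussianPDFDeriv3 V (z - y - s)) (fun s => ?_) ?_ ?_ hD).trans ?_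
      · have h := (hasDerivAt_gaussianPDFDeriv2 hV (z - y - s)).comp s
          ((hasDerivAt_id s).const_sub (z - y))
        simpa [Function.comp_def] using h
      · exact ((integrable_gaussianPDFDeriv3 hV).comp_sub_left (z - y)).neg
      · exact (tendsto_gaussianPDFDeriv2_atBot hV).comp
          (tendsto_atBot_add_const_left _ (z - y) tendsto_neg_atTop_atBot)
      · simp only [abs_neg]
        rw [integral_sub_left_eq_self (fun x => |gaussianPDFDeriv3 V x|) volume (z - y)]
        have hD0 : 0 ≤ D := (abs_nonneg _).trans (hD 0)
        calc _ ≤ D * (32 * (√V ^ 3)⁻¹) := by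
              gcongr
              exact integral_abs_gaussianPDFDeriv3_le hV
          _ = _ := by ring) hν hγ
    ((integrable_cdf_sub ν _ z).sub (integrable_cdf_sub ν _ z))
    ((integrable_cdf_sub _ _ z).sub (integrable_cdf_sub _ _ z)) g1 g2
  -- the smoothed normal distribution function
  have hk : ∀ y, _ := fun y => hasDerivAt_cdf_conv_gaussianReal hkV (Measure.dirac 0) z y
  have hH := abs_integral_sub_le_third_moment
    (fun y => (hk y).1) (fun y => (hk y).2.1) (fun y => (hk y).2.2) (M := (√(k + V : ℝ≥0) ^ 3)⁻¹)
    (fun y => by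
      rw [integral_dirac, abs_neg]
      exact abs_gaussianPDFDeriv2_le hkV _) hν hγ
    (integrable_cdf_sub ν _ z) (integrable_cdf_sub _ _ z) g1 g2
  have hconv : (Measure.dirac 0).conv (gaussianReal 0 (k + V)) =
      (gaussianReal 0 k).conv (gaussianReal 0 V) := by
    rw [Measure.dirac_zero_conv, gaussianReal_conv_gaussianReal, add_zero]
  rw [hconv] at hH
  rw [comm ν, comm (gaussianReal 0 1)]
  simp only [Pi.sub_apply] at hG
  rw [integral_sub (integrable_cdf_sub ν _ z) (integrable_cdf_sub ν _ z),
    integral_sub (integrable_cdf_sub _ _ z) (integrable_cdf_sub _ _ z)] at hG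
  rw [add_mul]
  refine le_trans ?_ (add_le_add hG hH)
  refine le_trans (le_of_eq ?_) (abs_add_le _ _)
  congr 1
  ring

/-! ### Removing the Gaussian smoothing -/

/-- A function which is at least `b` within two standard deviations and at least `-D` everywhere
has normal mean at least `b - (b + D) / 4`, by Chebyshev's inequality. -/
lemma sub_le_integral_gaussianReal {V : ℝ≥0} (hV : V ≠ 0) {f : ℝ → ℝ} (hf : Measurable f)
    {b D : ℝ} (hbD : 0 ≤ b + D) (hfD : ∀ u, |f u| ≤ D) (hfb : ∀ u, |u| ≤ 2 * √V → b ≤ f u) :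
    b - (b + D) / 4 ≤ ∫ u, f u ∂(gaussianReal 0 V) := by
  have hV' : (0 : ℝ) < V := by exact_mod_cast pos_iff_ne_zero.mpr hV
  have hm : MemLp id 2 (gaussianReal 0 V) := memLp_id_gaussianReal 2
  have isq : Integrable (fun u : ℝ => u ^ 2) (gaussianReal 0 V) := hm.integrable_sq
  have hsq : ∫ u, u ^ 2 ∂(gaussianReal 0 V) = V := by
    have h := variance_fun_id_gaussianReal (μ := 0) (v := V)
    rwa [variance_of_integral_eq_zero (by fun_prop) integral_id_gaussianReal] at h
  calc b - (b + D) / 4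
      = ∫ u, (b - (b + D) / (4 * V) * u ^ 2) ∂(gaussianReal 0 V) := by
        rw [integral_sub (integrable_const _) (isq.const_mul _), integral_const_mul, hsq]
        simp
        field_simp
    _ ≤ _ := by
        refine integral_mono ((integrable_const _).sub (isq.const_mul _))
          (Integrable.of_bound hf.aestronglyMeasurable D (.of_forall hfD)) fun u => ?_
        simp only
        rcases le_or_gt |u| (2 * √V) with hu | hu
        · have : 0 ≤ (b + D) / (4 * V) * u ^ 2 := by positivity
          linarith [hfb u hu]
        · have h4 : 4 * (V : ℝ) ≤ u ^ 2 := by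
            rw [← sq_abs u]
            nlinarith [Real.sq_sqrt hV'.le, Real.sqrt_nonneg (V : ℝ)]
          have : b + D ≤ (b + D) / (4 * V) * u ^ 2 := by
            rw [div_mul_eq_mul_div, le_div_iff₀ (by positivity)]
            gcongr
          linarith [(abs_le.mp (hfD u)).1]

/-- If `η'` has an `m`-Lipschitz distribution function, the Kolmogorov distance of `η` and `η'` is
controlled by that of their convolutions with a normal law. -/
lemma kolmogorovDist_le_of_smoothed {η η' : Measure ℝ} [IsProbabilityMeasure η]
    [IsProbabilityMeasure η'] {m : ℝ}
    (hm : ∀ x y, x ≤ y → cdf η' y - cdf η' x ≤ m * (y - x)) {V : ℝ≥0} (hV : V ≠ 0) {e : ℝ}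
    (he : ∀ z, |cdf (η.conv (gaussianReal 0 V)) z - cdf (η'.conv (gaussianReal 0 V)) z| ≤ e) :
    kolmogorovDist η η' ≤ 2 * e + 6 * m * √V := by
  set D := kolmogorovDist η η' with hDdef
  have hD : ∀ x, |cdf η x - cdf η' x| ≤ D := abs_cdf_sub_le_kolmogorovDist η η'
  have hD0 : 0 ≤ D := kolmogorovDist_nonneg η η'
  have he0 : 0 ≤ e := (abs_nonneg _).trans (he 0)
  have hs : 0 ≤ √(V : ℝ) := Real.sqrt_nonneg _
  have hm0 : 0 ≤ m := by
    have := hm 0 1 zero_le_one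
    linarith [monotone_cdf η' (zero_le_one (α := ℝ))]
  have hsm : ∀ z, cdf (η.conv (gaussianReal 0 V)) z - cdf (η'.conv (gaussianReal 0 V)) z =
      ∫ u, (cdf η (z - u) - cdf η' (z - u)) ∂(gaussianReal 0 V) := by
    intro z
    rw [Measure.conv_comm, cdf_conv, Measure.conv_comm, cdf_conv,
      integral_sub (integrable_cdf_sub _ _ _) (integrable_cdf_sub _ _ _)]
  have hmeas : ∀ z, Measurable fun u => cdf η (z - u) - cdf η' (z - u) := fun z =>
    (measurable_cdf_sub η z).sub (measurable_cdf_sub η' z)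
  have main : ∀ x, |cdf η x - cdf η' x| ≤ 4 * m * √V + (e + D / 4) * (4 / 3) := by
    intro x
    set b := |cdf η x - cdf η' x| - 4 * m * √V with hb
    rcases lt_or_ge (b + D) 0 with hbD | hbD
    · linarith
    have hfin : b - (b + D) / 4 ≤ e := by
      rcases le_or_gt 0 (cdf η x - cdf η' x) with h0 | h0
      · rw [abs_of_nonneg h0] at hb
        have := sub_le_integral_gaussianReal hV (hmeas (x + 2 * √V)) hbD (fun u => hD _)
          (fun u hu => by
            have h1 := abs_le.mp hu
            have h2 := monotone_cdf η (show x ≤ x + 2 * √V - u by linarith)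
            have h3 := hm x (x + 2 * √V - u) (by linarith)
            have h4 : m * (x + 2 * √V - u - x) ≤ m * (4 * √V) := by gcongr; linarith
            linarith)
        rw [← hsm] at this
        exact this.trans ((le_abs_self _).trans (he _))
      · rw [abs_of_neg h0] at hb
        have := sub_le_integral_gaussianReal hV (hmeas (x - 2 * √V)).neg hbD
          (fun u => by simpa [abs_sub_comm] using hD (x - 2 * √V - u))
          (fun u hu => by
            have h1 := abs_le.mp hu
            have h2 := monotone_cdf η (show x - 2 * √V - u ≤ x by linarith)
            have h3 := hm (x - 2 * √V - u) x (by linarith)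
            have h4 : m * (x - (x - 2 * √V - u)) ≤ m * (4 * √V) := by gcongr; linarith
            simp only [Pi.neg_apply]
            linarith)
        simp only [Pi.neg_apply] at this
        rw [integral_neg, ← hsm] at this
        exact this.trans ((neg_le_abs _).trans (he _))
    linarith
  have : D ≤ 4 * m * √V + (e + D / 4) * (4 / 3) := ciSup_le main
  linarith

/-! ### The Berry-Esseen theorem -/

lemma inv_sqrt_pow_three_le {x : ℝ} (hx : 1 ≤ x) :
    (√x ^ 3)⁻¹ ≤ 4 * ((√x)⁻¹ - (√(x + 1))⁻¹) := by
  have hp : 1 ≤ √x := Real.one_le_sqrt.mpr hx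
  have hq : √x ≤ √(x + 1) := Real.sqrt_le_sqrt (by linarith)
  have hp2 : √x ^ 2 = x := Real.sq_sqrt (by linarith)
  have hq2 : √(x + 1) ^ 2 = x + 1 := Real.sq_sqrt (by linarith)
  set p := √x
  set q := √(x + 1)
  have hp0 : 0 < p := by linarith
  have hq0 : 0 < q := by linarith
  have e : p⁻¹ - q⁻¹ = (p * q * (q + p))⁻¹ := by
    have : q - p = (q + p)⁻¹ := by
      apply eq_inv_of_mul_eq_one_left
      nlinarith
    rw [mul_inv, ← this]
    field_simp
  rw [e, ← div_eq_mul_inv, ← one_div, div_le_div_iff₀ (by positivity) (by positivity)]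
  have : q * (q + p) ≤ 4 * p ^ 2 := by nlinarith [sq_nonneg (q - p)]
  nlinarith

lemma sum_inv_sqrt_pow_three_le {a : ℝ} (ha : 1 ≤ a) (n : ℕ) :
    ∑ j ∈ Finset.range n, (√(a + j) ^ 3)⁻¹ ≤ 4 * (√a)⁻¹ := by
  have h : ∑ j ∈ Finset.range n, (√(a + j) ^ 3)⁻¹ ≤ 4 * ((√a)⁻¹ - (√(a + n))⁻¹) := by
    induction n with
    | zero => simp
    | succ n ih =>
      rw [Finset.sum_range_succ]
      have := inv_sqrt_pow_three_le (x := a + n) (by linarith [n.cast_nonneg (α := ℝ)])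
      push_cast
      rw [← add_assoc]
      linarith
  have : 0 ≤ (√(a + n))⁻¹ := by positivity
  linarith

/-- Lindeberg's telescoping: exchanging the summands of an i.i.d. sum one after the other for
standard normal ones, in the presence of a further normal component of variance `E`. -/
lemma abs_cdf_sumLaw_conv_sub_le {ν : Measure ℝ} [IsProbabilityMeasure ν] (hν : MemLp id 3 ν)
    (m1 : ∫ x, x ∂ν = 0) (m2 : ∫ x, x ^ 2 ∂ν = 1) {E : ℝ≥0} (hE : E ≠ 0) (n : ℕ) (z : ℝ) :
    |cdf ((sumLaw ν n).conv (gaussianReal 0 E)) z -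
        cdf ((gaussianReal 0 n).conv (gaussianReal 0 E)) z| ≤
      ∑ k ∈ Finset.range n, (32 * kolmogorovDist (sumLaw ν k) (gaussianReal 0 k) *
          (√(E + (n - 1 - k : ℕ)) ^ 3)⁻¹ + (√(E + (n - 1 : ℕ)) ^ 3)⁻¹) *
        (∫ x, |x| ^ 3 ∂ν + ∫ x, |x| ^ 3 ∂(gaussianReal 0 1)) := by
  set T : ℕ → ℝ := fun k => cdf ((sumLaw ν k).conv (gaussianReal 0 (E + (n - k : ℕ)))) z with hT
  have hTn : T n = cdf ((sumLaw ν n).conv (gaussianReal 0 E)) z := by simp [hT]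
  have hT0 : T 0 = cdf ((gaussianReal 0 n).conv (gaussianReal 0 E)) z := by
    simp only [hT, sumLaw_zero, Measure.dirac_zero_conv, gaussianReal_conv_gaussianReal, add_zero,
      Nat.sub_zero, add_comm]
  rw [← hTn, ← hT0, ← Finset.sum_range_sub]
  refine (Finset.abs_sum_le_sum_abs _ _).trans (Finset.sum_le_sum fun k hk => ?_)
  have hk' : k < n := Finset.mem_range.mp hk
  have hV : E + (n - 1 - k : ℕ) ≠ 0 := by positivity
  have h := abs_cdf_exchange_le hν m1 m2 (η := sumLaw ν k) (k := k) hV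
    (abs_cdf_sub_le_kolmogorovDist (sumLaw ν k) (gaussianReal 0 k)) z
  have e1 : T (k + 1) =
      cdf (((sumLaw ν k).conv (gaussianReal 0 (E + (n - 1 - k : ℕ)))).conv ν) z := by
    simp only [hT, sumLaw_succ]
    rw [Measure.conv_assoc, Measure.conv_assoc, Measure.conv_comm ν,
      show n - (k + 1) = n - 1 - k by omega]
  have e2 : T k = cdf (((sumLaw ν k).conv (gaussianReal 0 (E + (n - 1 - k : ℕ)))).conv
      (gaussianReal 0 1)) z := by
    simp only [hT]
    rw [Measure.conv_assoc, gaussianReal_conv_gaussianReal, add_zero, add_assoc,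
      show n - k = n - 1 - k + 1 by omega]
    push_cast
    rfl
  rw [e1, e2]
  refine h.trans (le_of_eq ?_)
  have e3 : ((k + (E + (n - 1 - k : ℕ)) : ℝ≥0) : ℝ) = E + (n - 1 : ℕ) := by
    simp only [NNReal.coe_add, NNReal.coe_natCast]
    have : ((n - 1 : ℕ) : ℝ) = k + (n - 1 - k : ℕ) := by
      rw [← Nat.cast_add]; congr 1; omega
    rw [this]; ring
  rw [e3]
  simp only [NNReal.coe_add, NNReal.coe_natCast]

/-- The Berry-Esseen theorem for standardized summands. -/
theorem kolmogorovDist_sumLaw_le {ν : Measure ℝ} [IsProbabilityMeasure ν] (hν : MemLp id 3 ν)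
    (m1 : ∫ x, x ∂ν = 0) (m2 : ∫ x, x ^ 2 ∂ν = 1) {n : ℕ} (hn : 0 < n) :
    kolmogorovDist (sumLaw ν n) (gaussianReal 0 n) ≤
      12676 * (1 + ∫ x, |x| ^ 3 ∂(gaussianReal 0 1)) * (∫ x, |x| ^ 3 ∂ν) / √n := by
  set g := ∫ x, |x| ^ 3 ∂(gaussianReal 0 1) with hg
  set ρ := ∫ x, |x| ^ 3 ∂ν with hρ
  have hg0 : 0 ≤ g := integral_nonneg fun x => by positivity
  have hρ1 : 1 ≤ ρ := by
    have i3 : Integrable (fun x : ℝ => |x| ^ 3) ν := by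
      simpa using hν.integrable_norm_pow (p := 3) (by norm_num)
    have i2 : Integrable (fun x : ℝ => x ^ 2) ν := (hν.mono_exponent (by norm_num)).integrable_sq
    have : ∫ x, x ^ 2 ∂ν ≤ ∫ x, (1 / 3 + 2 / 3 * |x| ^ 3) ∂ν := by
      refine integral_mono i2 ((integrable_const _).add (i3.const_mul _)) fun x => ?_
      simp only
      rw [← sq_abs x]
      nlinarith [abs_nonneg x, mul_nonneg (abs_nonneg x) (sq_nonneg (|x| - 1)),
        sq_nonneg (|x| - 1)]
    rw [m2, integral_add (integrable_const _) (i3.const_mul _), integral_const_mul] at this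
    simp at this
    linarith
  set κ := 1 + g with hκ
  set A := 12676 * κ with hA
  have hκ1 : 1 ≤ κ := by linarith
  induction n using Nat.strong_induction_on with
  | _ n ih =>
  have hn1 : (1 : ℝ) ≤ n := by exact_mod_cast hn
  have hsn : 0 < √(n : ℝ) := Real.sqrt_pos.mpr (by linarith)
  have hsn2 : √(n : ℝ) ^ 2 = n := Real.sq_sqrt (by linarith)
  -- the smoothing level is proportional to the third moment, with a constant large enough to
  -- make the recursion for the Kolmogorov distances a contraction
  set ε : ℝ := 1024 * κ * ρ with hε
  have hκρ : 1 ≤ κ * ρ := one_le_mul_of_one_le_of_one_le hκ1 hρ1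
  have hε1 : 1 ≤ ε := by nlinarith
  set E : ℝ≥0 := Real.toNNReal (ε ^ 2) with hEdef
  have hE : (E : ℝ) = ε ^ 2 := Real.coe_toNNReal _ (by positivity)
  have hE1 : (1 : ℝ) ≤ E := by rw [hE]; exact one_le_pow₀ hε1
  have hE0 : E ≠ 0 := by
    intro h; rw [h] at hE1; simp at hE1; linarith
  have hsE : √(E : ℝ) = ε := by rw [hE, Real.sqrt_sq (by linarith)]
  have hn0 : (n : ℝ≥0) ≠ 0 := by positivity
  -- summands with small index are bounded trivially, the others by induction
  have hterm : ∀ k ∈ Finset.range n, kolmogorovDist (sumLaw ν k) (gaussianReal 0 k) *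
      (√(E + (n - 1 - k : ℕ)) ^ 3)⁻¹ ≤
      2 * A * ρ / √n * (√(E + (n - 1 - k : ℕ)) ^ 3)⁻¹ + 3 * (√n ^ 3)⁻¹ := by
    intro k hk
    have hk' : k < n := Finset.mem_range.mp hk
    have hVpos : (0 : ℝ) < E + (n - 1 - k : ℕ) := by positivity
    have hsV : 0 < √((E : ℝ) + (n - 1 - k : ℕ)) := Real.sqrt_pos.mpr hVpos
    rcases le_or_gt n (2 * k) with h2 | h2
    · have hk0 : 0 < k := by omega
      have hkr : (1 : ℝ) ≤ k := by exact_mod_cast hk0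
      have hsk : 0 < √(k : ℝ) := Real.sqrt_pos.mpr (by linarith)
      have h1 := ih k hk' hk0
      have h3 : √(n : ℝ) ≤ 2 * √k := by
        rw [show (2 : ℝ) * √k = √(2 ^ 2 * k) by
          rw [Real.sqrt_mul (x := 2 ^ 2) (by positivity), Real.sqrt_sq (by norm_num)]]
        apply Real.sqrt_le_sqrt
        have : (n : ℝ) ≤ 2 * k := by exact_mod_cast h2
        linarith
      have h4 : A * ρ / √k ≤ 2 * A * ρ / √n := by
        rw [div_le_div_iff₀ hsk hsn]
        have : 0 ≤ A * ρ := by positivity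
        nlinarith
      have h5 : 0 ≤ 3 * (√(n : ℝ) ^ 3)⁻¹ := by positivity
      have h6 := mul_le_mul_of_nonneg_right (h1.trans h4)
        (show 0 ≤ (√((E : ℝ) + (n - 1 - k : ℕ)) ^ 3)⁻¹ by positivity)
      linarith
    · have hV2 : (n : ℝ) ≤ 2 * (E + (n - 1 - k : ℕ)) := by
        have : (n : ℝ) ≤ 2 * ((1 : ℕ) + (n - 1 - k : ℕ)) := by
          exact_mod_cast (by omega : n ≤ 2 * (1 + (n - 1 - k)))
        push_cast at this
        linarith
      have h3 : √(n : ℝ) ≤ 1.42 * √(E + (n - 1 - k : ℕ)) := by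
        rw [show (1.42 : ℝ) * √(E + (n - 1 - k : ℕ)) = √(1.42 ^ 2 * (E + (n - 1 - k : ℕ))) by
          rw [Real.sqrt_mul (x := 1.42 ^ 2) (by positivity), Real.sqrt_sq (by norm_num)]]
        apply Real.sqrt_le_sqrt
        linarith
      have h4 : (√((E : ℝ) + (n - 1 - k : ℕ)) ^ 3)⁻¹ ≤ 3 * (√n ^ 3)⁻¹ := by
        rw [← div_eq_mul_inv, ← one_div, div_le_div_iff₀ (by positivity) (by positivity)]
        have := pow_le_pow_left₀ hsn.le h3 3
        rw [mul_pow] at this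
        have h0 : 0 < √((E : ℝ) + (n - 1 - k : ℕ)) ^ 3 := by positivity
        linarith
      have hD1 : kolmogorovDist (sumLaw ν k) (gaussianReal 0 k) ≤ 1 :=
        ciSup_le (abs_cdf_sub_cdf_le_one _ _)
      have h5 := mul_le_mul_of_nonneg_right hD1
        (show 0 ≤ (√((E : ℝ) + (n - 1 - k : ℕ)) ^ 3)⁻¹ by positivity)
      have h6 : 0 ≤ 2 * A * ρ / √n * (√((E : ℝ) + (n - 1 - k : ℕ)) ^ 3)⁻¹ := by positivity
      linarith
  have hn3 : (n : ℝ) * (√n ^ 3)⁻¹ = (√n)⁻¹ := by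
    nth_rw 1 [← hsn2]
    field_simp
  have hsum1 : ∑ k ∈ Finset.range n, kolmogorovDist (sumLaw ν k) (gaussianReal 0 k) *
      (√(E + (n - 1 - k : ℕ)) ^ 3)⁻¹ ≤ (8 * A * ρ / ε + 3) * (√n)⁻¹ := by
    refine (Finset.sum_le_sum hterm).trans ?_
    rw [Finset.sum_add_distrib, ← Finset.mul_sum,
      Finset.sum_range_reflect (fun j => (√((E : ℝ) + (j : ℕ)) ^ 3)⁻¹) n, Finset.sum_const,
      Finset.card_range, nsmul_eq_mul]
    have h1 := sum_inv_sqrt_pow_three_le hE1 n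
    rw [hsE] at h1
    calc _ ≤ 2 * A * ρ / √n * (4 * ε⁻¹) + n * (3 * (√n ^ 3)⁻¹) := by gcongr
      _ = 2 * A * ρ / √n * (4 * ε⁻¹) + 3 * (n * (√n ^ 3)⁻¹) := by ring
      _ = _ := by rw [hn3]; ring
  have hlast : (√((E : ℝ) + (n - 1 : ℕ)) ^ 3)⁻¹ ≤ (√n ^ 3)⁻¹ := by
    gcongr
    rw [Nat.cast_sub hn]
    push_cast
    linarith
  have hκρ2 : ρ + g ≤ κ * ρ := by nlinarith
  have hsmooth : ∀ z, |cdf ((sumLaw ν n).conv (gaussianReal 0 E)) z -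
      cdf ((gaussianReal 0 n).conv (gaussianReal 0 E)) z| ≤
      (256 * A * ρ / ε + 97) * (√n)⁻¹ * (κ * ρ) := by
    intro z
    refine (abs_cdf_sumLaw_conv_sub_le hν m1 m2 hE0 n z).trans ?_
    rw [← Finset.sum_mul, Finset.sum_add_distrib, Finset.sum_const, Finset.card_range,
      nsmul_eq_mul]
    simp_rw [mul_assoc (32 : ℝ)]
    rw [← Finset.mul_sum]
    have hpos : 0 ≤ (256 * A * ρ / ε + 97) * (√(n : ℝ))⁻¹ := by positivity
    refine mul_le_mul ?_ hκρ2 (by positivity) hpos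
    calc _ ≤ 32 * ((8 * A * ρ / ε + 3) * (√n)⁻¹) + n * (√n ^ 3)⁻¹ := by gcongr
      _ = _ := by rw [hn3]; ring
  have := kolmogorovDist_le_of_smoothed (η := sumLaw ν n) (η' := gaussianReal 0 n)
    (fun x y hxy => cdf_gaussianReal_sub_le hn0 hxy) hE0 hsmooth
  refine this.trans (le_of_eq ?_)
  rw [hsE, hε, hA]
  have hκ0 : κ ≠ 0 := by linarith
  have hρ0 : ρ ≠ 0 := by linarith
  simp only [NNReal.coe_natCast]
  field_simp
  ring

lemma memLp_id_three_of_integrable {ν : Measure ℝ} (h : Integrable (fun x => |x| ^ 3) ν) :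
    MemLp id 3 ν := by
  have := (integrable_norm_rpow_iff (f := (id : ℝ → ℝ)) (p := 3) (μ := ν)
    aestronglyMeasurable_id (by norm_num) (by norm_num)).mp
  apply this
  simpa using h

lemma integrable_abs_pow_three {ν : Measure ℝ} (h : MemLp id 3 ν) :
    Integrable (fun x : ℝ => |x| ^ 3) ν := by
  rcases eq_or_ne ν 0 with rfl | _
  · simp
  · have := h.integrable_norm_rpow (by norm_num) (by norm_num)
    simpa using this

lemma sumLaw_map_const_mul (ν : Measure ℝ) [IsProbabilityMeasure ν] (r : ℝ) (n : ℕ) :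
    sumLaw (ν.map (r * ·)) n = (sumLaw ν n).map (r * ·) := by
  have := Measure.isProbabilityMeasure_map (μ := ν) (f := (r * ·)) (by fun_prop)
  apply Measure.ext_of_charFun
  ext z
  rw [charFun_sumLaw, charFun_map_mul, charFun_map_mul, charFun_sumLaw]

lemma sumLaw_map_add_const (ν : Measure ℝ) [IsProbabilityMeasure ν] (r : ℝ) (n : ℕ) :
    sumLaw (ν.map (· + r)) n = (sumLaw ν n).map (· + n * r) := by
  have := Measure.isProbabilityMeasure_map (μ := ν) (f := (· + r)) (by fun_prop)
  apply Measure.ext_of_charFun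
  ext z
  rw [charFun_sumLaw, charFun_map_add_const, charFun_map_add_const, charFun_sumLaw, mul_pow,
    ← Complex.exp_nat_mul]
  congr 2
  simp
  ring

lemma cdf_map_const_mul (η : Measure ℝ) [IsProbabilityMeasure η] {r : ℝ} (hr : 0 < r) (x : ℝ) :
    cdf (η.map (r * ·)) (r * x) = cdf η x := by
  have := Measure.isProbabilityMeasure_map (μ := η) (f := (r * ·)) (by fun_prop)
  rw [cdf_eq_real, cdf_eq_real, map_measureReal_apply (by fun_prop) measurableSet_Iic]
  congr 1
  ext y
  simp [mul_le_mul_iff_right₀ hr]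

lemma cdf_map_add_const (η : Measure ℝ) [IsProbabilityMeasure η] (r x : ℝ) :
    cdf (η.map (· + r)) (x + r) = cdf η x := by
  have := Measure.isProbabilityMeasure_map (μ := η) (f := (· + r)) (by fun_prop)
  rw [cdf_eq_real, cdf_eq_real, map_measureReal_apply (by fun_prop) measurableSet_Iic]
  congr 1
  ext y
  simp

lemma measureReal_pi_sum_div_le (ν : Measure ℝ) [IsProbabilityMeasure ν] (n : ℕ) {r : ℝ}
    (hr : 0 < r) (x : ℝ) :
    (Measure.pi fun _ : Fin n => ν).real {y | (∑ i, y i) / r ≤ x} = cdf (sumLaw ν n) (r * x) := by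
  rw [cdf_eq_real, sumLaw, map_measureReal_apply (by fun_prop) measurableSet_Iic]
  congr 1
  ext y
  simp [div_le_iff₀ hr, mul_comm]

/-- The Berry-Esseen theorem: some constant is admissible. -/
theorem isBerryEsseenBound_explicit :
    IsBerryEsseenBound (12676 * (1 + ∫ x, |x| ^ 3 ∂(gaussianReal 0 1))) := by
  intro ν _ h3 h1 h2 n hn x
  set s := √(∫ u, u ^ 2 ∂ν) with hs
  have hs0 : 0 < s := Real.sqrt_pos.mpr h2
  have hn0 : (0 : ℝ) < n := by exact_mod_cast hn
  have hsn : 0 < √(n : ℝ) := Real.sqrt_pos.mpr hn0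
  have hsn2 : √(n : ℝ) ^ 2 = n := Real.sq_sqrt hn0.le
  have hp := Measure.isProbabilityMeasure_map (μ := ν) (f := (s⁻¹ * ·)) (by fun_prop)
  have e3 : ∫ u, |u| ^ 3 ∂(ν.map (s⁻¹ * ·)) = (∫ u, |u| ^ 3 ∂ν) / s ^ 3 := by
    rw [integral_map (by fun_prop) (by fun_prop : Continuous _).aestronglyMeasurable,
      ← integral_div]
    refine integral_congr_ae (.of_forall fun u => ?_)
    simp only [abs_mul, abs_inv, abs_of_pos hs0]
    field_simp
  have key := abs_cdf_sub_le_kolmogorovDist (sumLaw (ν.map (s⁻¹ * ·)) n) (gaussianReal 0 n)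
    (√n * x)
  have hB := kolmogorovDist_sumLaw_le (ν := ν.map (s⁻¹ * ·)) ?_ ?_ ?_ hn
  · rw [measureReal_pi_sum_div_le ν n (by positivity)]
    have c1 : cdf (sumLaw ν n) (s * √n * x) = cdf (sumLaw (ν.map (s⁻¹ * ·)) n) (√n * x) := by
      rw [sumLaw_map_const_mul, ← cdf_map_const_mul (sumLaw ν n) (r := s⁻¹) (by positivity)]
      congr 1
      field_simp
    have c2 : cdf (gaussianReal 0 1) x = cdf (gaussianReal 0 n) (√n * x) := by
      rw [← cdf_map_const_mul (gaussianReal 0 1) hsn, gaussianReal_map_const_mul]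
      congr 3
      · simp
      · ext
        simp
    rw [c1, c2]
    refine key.trans (hB.trans (le_of_eq ?_))
    rw [e3]
    field_simp
  · apply memLp_id_three_of_integrable
    rw [integrable_map_measure (by fun_prop : Continuous _).aestronglyMeasurable (by fun_prop)]
    have : (fun x : ℝ => |x| ^ 3) ∘ (s⁻¹ * ·) = fun x => s⁻¹ ^ 3 * |x| ^ 3 := by
      ext u
      simp [abs_mul, mul_pow, abs_of_pos hs0]
    rw [this]
    exact h3.const_mul _
  · rw [integral_map (by fun_prop) (by fun_prop : Continuous _).aestronglyMeasurable,
      integral_const_mul, h1, mul_zero]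
  · rw [integral_map (by fun_prop) (by fun_prop : Continuous _).aestronglyMeasurable]
    simp only [mul_pow]
    rw [integral_const_mul, inv_pow, hs, Real.sq_sqrt h2.le]
    exact inv_mul_cancel₀ h2.ne'

lemma integral_abs_pow_three_pos {ν : Measure ℝ} (h3 : Integrable (fun x => |x| ^ 3) ν)
    (h2 : 0 < ∫ x, x ^ 2 ∂ν) : 0 < ∫ x, |x| ^ 3 ∂ν := by
  have h0 : 0 ≤ ∫ x, |x| ^ 3 ∂ν := integral_nonneg fun x => by positivity
  refine h0.lt_of_ne' fun h => h2.ne' ?_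
  rw [integral_eq_zero_iff_of_nonneg (fun x => by positivity) h3] at h
  rw [← integral_zero ℝ ℝ (μ := ν)]
  refine integral_congr_ae (h.mono fun x hx => ?_)
  simpa using hx

/-- The infimum defining the constant of the Berry-Esseen theorem is attained. -/
theorem isBerryEsseenBound_berryEsseenConstant : IsBerryEsseenBound berryEsseenConstant := by
  intro ν _ h3 h1 h2 n hn x
  have hn0 : (0 : ℝ) < n := by exact_mod_cast hn
  have hpos := integral_abs_pow_three_pos h3 h2
  have hs : 0 < √(∫ u, u ^ 2 ∂ν) ^ 3 * √(n : ℝ) :=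
    mul_pos (pow_pos (Real.sqrt_pos.mpr h2) 3) (Real.sqrt_pos.mpr hn0)
  rw [le_div_iff₀ hs, ← div_le_iff₀ hpos]
  refine le_csInf ⟨_, isBerryEsseenBound_explicit⟩ fun C hC => ?_
  have := hC ν inferInstance h3 h1 h2 n hn x
  rwa [le_div_iff₀ hs, ← div_le_iff₀ hpos] at this

lemma berryEsseenConstant_nonneg : 0 ≤ berryEsseenConstant := by
  have i3 := integrable_abs_pow_three (memLp_id_gaussianReal 3 (μ := 0) (v := 1))
  have h2 : 0 < ∫ x, x ^ 2 ∂(gaussianReal 0 1) := by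
    have h := variance_fun_id_gaussianReal (μ := 0) (v := 1)
    rw [variance_of_integral_eq_zero (by fun_prop) integral_id_gaussianReal] at h
    rw [h]; simp
  have := isBerryEsseenBound_berryEsseenConstant (gaussianReal 0 1) inferInstance i3
    integral_id_gaussianReal h2 1 one_pos 0
  have h3 := (abs_nonneg _).trans this
  have hpos := integral_abs_pow_three_pos i3 h2
  by_contra hneg
  push Not at hneg
  refine absurd h3 (not_le.mpr (div_neg_of_neg_of_pos (mul_neg_of_neg_of_pos hneg hpos) ?_))
  exact mul_pos (pow_pos (Real.sqrt_pos.mpr h2) 3) (Real.sqrt_pos.mpr (by norm_num))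

/-- The Berry-Esseen inequality for sums of summands which are neither centred nor normalized. -/
lemma abs_cdf_sumLaw_sub_gaussianReal_le {ν : Measure ℝ} [IsProbabilityMeasure ν]
    (hν : MemLp id 3 ν) {m v : ℝ} (hm : ∫ x, x ∂ν = m) (hv : ∫ x, (x - m) ^ 2 ∂ν = v)
    (hv0 : 0 < v) {n : ℕ} (hn : 0 < n) (x : ℝ) :
    |cdf (sumLaw ν n) x - cdf (gaussianReal (n * m) (n * v).toNNReal) x| ≤
      berryEsseenConstant * (∫ u, |u - m| ^ 3 ∂ν) / (√v ^ 3 * √n) := by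
  have hn0 : (0 : ℝ) < n := by exact_mod_cast hn
  have hp := Measure.isProbabilityMeasure_map (μ := ν) (f := (· + -m)) (by fun_prop)
  have e2 : ∫ u, u ^ 2 ∂(ν.map (· + -m)) = v := by
    rw [integral_map (by fun_prop) (by fun_prop : Continuous _).aestronglyMeasurable, ← hv]
    rfl
  have e3 : ∫ u, |u| ^ 3 ∂(ν.map (· + -m)) = ∫ u, |u - m| ^ 3 ∂ν := by
    rw [integral_map (by fun_prop) (by fun_prop : Continuous _).aestronglyMeasurable]
    rfl
  set r := √v * √(n : ℝ) with hr
  have hr0 : 0 < r := mul_pos (Real.sqrt_pos.mpr hv0) (Real.sqrt_pos.mpr hn0)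
  have h := isBerryEsseenBound_berryEsseenConstant (ν.map (· + -m)) inferInstance ?_ ?_ ?_ n hn
    ((x - n * m) / r)
  · rw [e2, e3, measureReal_pi_sum_div_le _ n hr0] at h
    have c1 : cdf (sumLaw (ν.map (· + -m)) n) (r * ((x - n * m) / r)) = cdf (sumLaw ν n) x := by
      rw [sumLaw_map_add_const, ← cdf_map_add_const (sumLaw ν n) (n * -m)]
      congr 1
      field_simp
      ring
    have c2 : cdf (gaussianReal 0 1) ((x - n * m) / r) =
        cdf (gaussianReal (n * m) (n * v).toNNReal) x := by
      rw [← cdf_map_const_mul (gaussianReal 0 1) hr0, gaussianReal_map_const_mul,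
        ← cdf_map_add_const _ (n * m), gaussianReal_map_add_const]
      congr 1
      · congr 2
        · ring
        · ext
          rw [Real.coe_toNNReal _ (by positivity)]
          simp [hr, mul_pow, Real.sq_sqrt hv0.le, mul_comm]
      · field_simp
        ring
    rwa [c1, c2] at h
  · rw [integrable_map_measure (by fun_prop : Continuous _).aestronglyMeasurable (by fun_prop)]
    exact integrable_abs_pow_three (ν := ν.map (· + -m)) (by
      rw [memLp_map_measure_iff aestronglyMeasurable_id (by fun_prop)]
      exact hν.add (memLp_const (-m))) |>.comp_measurable (by fun_prop)
  · rw [integral_map (by fun_prop) (by fun_prop : Continuous _).aestronglyMeasurable,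
      integral_add (f := fun x => x) (hν.integrable (by norm_num)) (integrable_const _), hm]
    simp
  · rw [e2]; exact hv0

/-! ### Moments of the Lévy measure -/

section LevyMeasure

variable {α β lam : ℝ}

lemma measurable_levyDensity (α β lam : ℝ) : Measurable fun x : ℝ =>
    ENNReal.ofReal (if 0 < x then α / x ^ (1 + β) * Real.exp (-lam * x) else 0) := by
  refine ENNReal.measurable_ofReal.comp (Measurable.ite measurableSet_Ioi ?_ measurable_const)
  fun_prop

lemma integrable_oneSidedLevyMeasure_iff {E : Type*} [NormedAddCommGroup E] [NormedSpace ℝ E]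
    (hα : 0 < α) (f : ℝ → E) :
    Integrable f (oneSidedLevyMeasure α β lam) ↔
      IntegrableOn (fun x => (α / x ^ (1 + β) * Real.exp (-lam * x)) • f x) (Set.Ioi 0) := by
  rw [oneSidedLevyMeasure, integrable_withDensity_iff_integrable_smul' (measurable_levyDensity ..)
    (by simp), ← integrable_indicator_iff measurableSet_Ioi]
  refine integrable_congr (.of_forall fun x => ?_)
  by_cases hx : 0 < x
  · simp only
    rw [Set.indicator_of_mem (Set.mem_Ioi.mpr hx), if_pos hx, ENNReal.toReal_ofReal]
    have := Real.rpow_pos_of_pos hx (1 + β)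
    positivity
  · simp [hx]

lemma integral_oneSidedLevyMeasure {E : Type*} [NormedAddCommGroup E] [NormedSpace ℝ E]
    (hα : 0 < α) (f : ℝ → E) :
    ∫ x, f x ∂(oneSidedLevyMeasure α β lam) =
      ∫ x in Set.Ioi 0, (α / x ^ (1 + β) * Real.exp (-lam * x)) • f x := by
  rw [oneSidedLevyMeasure, integral_withDensity_eq_integral_toReal_smul
    (measurable_levyDensity ..) (by simp), ← integral_indicator measurableSet_Ioi]
  refine integral_congr_ae (.of_forall fun x => ?_)
  by_cases hx : 0 < x
  · simp only
    rw [Set.indicator_of_mem (Set.mem_Ioi.mpr hx), if_pos hx, ENNReal.toReal_ofReal]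
    have := Real.rpow_pos_of_pos hx (1 + β)
    positivity
  · simp [hx]

/-- The integrand of the `k`-th moment is that of a Gamma integral. -/
lemma levyDensity_mul_pow (k : ℕ) {x : ℝ} (hx : 0 < x) :
    (α / x ^ (1 + β) * Real.exp (-lam * x)) • x ^ k =
      α * (x ^ ((k - β : ℝ) - 1) * Real.exp (-(lam * x))) := by
  have : x ^ ((k - β : ℝ) - 1) = x ^ k / x ^ (1 + β) := by
    rw [← Real.rpow_natCast, ← Real.rpow_sub hx]
    congr 1
    ring
  rw [this, smul_eq_mul, neg_mul]
  ring

lemma integrable_pow_oneSidedLevyMeasure (hα : 0 < α) (hβ : β < 1) (hlam : 0 < lam) {k : ℕ}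
    (hk : 1 ≤ k) : Integrable (fun x => x ^ k) (oneSidedLevyMeasure α β lam) := by
  have hk' : (1 : ℝ) ≤ k := by exact_mod_cast hk
  rw [integrable_oneSidedLevyMeasure_iff hα]
  refine IntegrableOn.congr_fun ?_ (fun x hx => (levyDensity_mul_pow k hx).symm) measurableSet_Ioi
  refine Integrable.const_mul ?_ α
  have := integrableOn_rpow_mul_exp_neg_mul_rpow (p := 1) (s := (k - β : ℝ) - 1) (b := lam)
    (by linarith) one_pos hlam
  refine this.congr_fun (fun x _ => ?_) measurableSet_Ioi
  simp

lemma integral_pow_oneSidedLevyMeasure (hα : 0 < α) (hβ : β < 1) (hlam : 0 < lam) {k : ℕ}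
    (hk : 1 ≤ k) : ∫ x, x ^ k ∂(oneSidedLevyMeasure α β lam) =
      α * ((1 / lam) ^ (k - β : ℝ) * Real.Gamma (k - β)) := by
  have hk' : (1 : ℝ) ≤ k := by exact_mod_cast hk
  rw [integral_oneSidedLevyMeasure hα,
    setIntegral_congr_fun measurableSet_Ioi (fun x hx => levyDensity_mul_pow k hx),
    integral_const_mul, Real.integral_rpow_mul_exp_neg_mul_Ioi (by linarith) hlam]

/-- The `k`-th moment of the Lévy measure, i.e. the `k`-th cumulant of `TS(α, β, lam)`. -/
noncomputable def levyMoment (α β lam : ℝ) (k : ℕ) : ℝ :=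
  ∫ x, x ^ k ∂(oneSidedLevyMeasure α β lam)

lemma levyMoment_pos (hα : 0 < α) (hβ : β < 1) (hlam : 0 < lam) {k : ℕ} (hk : 1 ≤ k) :
    0 < levyMoment α β lam k := by
  have hk' : (1 : ℝ) ≤ k := by exact_mod_cast hk
  rw [levyMoment, integral_pow_oneSidedLevyMeasure hα hβ hlam hk]
  have := Real.Gamma_pos_of_pos (s := k - β) (by linarith)
  positivity

lemma levyMoment_succ (hα : 0 < α) (hβ : β < 1) (hlam : 0 < lam) {k : ℕ} (hk : 1 ≤ k) :
    levyMoment α β lam (k + 1) * lam = (k - β) * levyMoment α β lam k := by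
  have hk' : (1 : ℝ) ≤ k := by exact_mod_cast hk
  rw [levyMoment, levyMoment, integral_pow_oneSidedLevyMeasure hα hβ hlam hk,
    integral_pow_oneSidedLevyMeasure hα hβ hlam (by omega)]
  push_cast
  rw [show (k + 1 - β : ℝ) = (k - β) + 1 by ring, Real.Gamma_add_one (by linarith),
    Real.rpow_add_one (by positivity)]
  field_simp

end LevyMeasure

/-! ### The Lévy-Khintchine exponent -/

section Exponent

variable {F : Measure ℝ}

lemma norm_exp_sub_one_le (z x : ℝ) :
    ‖Complex.exp (Complex.I * z * x) - 1‖ ≤ |z| * |x| := by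
  have := Real.norm_exp_I_mul_ofReal_sub_one_le (x := z * x)
  rw [Real.norm_eq_abs, abs_mul] at this
  refine le_trans (le_of_eq ?_) this
  push_cast
  rw [mul_assoc]

lemma integrable_exp_sub_one (hF : Integrable (fun x : ℝ => x) F) (z : ℝ) :
    Integrable (fun x : ℝ => Complex.exp (Complex.I * z * x) - 1) F :=
  (hF.abs.const_mul |z|).mono' (by fun_prop : Continuous _).aestronglyMeasurable
    (.of_forall fun x => norm_exp_sub_one_le z x)

lemma norm_exp_integral_exp_sub_one_sq (hF : Integrable (fun x : ℝ => x) F) (z : ℝ) :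
    ‖Complex.exp (∫ x : ℝ, (Complex.exp (Complex.I * z * x) - 1) ∂F)‖ ^ 2 =
      Real.exp (-∫ x, (2 - 2 * Real.cos (z * x)) ∂F) := by
  rw [Complex.norm_exp, ← Real.exp_nat_mul]
  congr 1
  have h := (Complex.reCLM.integral_comp_comm (integrable_exp_sub_one hF z)).symm
  simp only [Complex.reCLM_apply] at h
  rw [h, ← integral_neg, Nat.cast_ofNat, ← integral_const_mul]
  refine integral_congr_ae (.of_forall fun x => ?_)
  simp only [Complex.sub_re, Complex.one_re]
  have : Complex.I * z * x = ((z * x : ℝ) : ℂ) * Complex.I := by push_cast; ring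
  rw [this, Complex.exp_ofReal_mul_I_re]
  ring

lemma hasDerivAt_integral_exp_sub_one (hF : Integrable (fun x : ℝ => x) F) :
    HasDerivAt (fun z : ℝ => ∫ x : ℝ, (Complex.exp (Complex.I * z * x) - 1) ∂F)
      (Complex.I * ∫ x, x ∂F) 0 := by
  have := hasDerivAt_integral_of_dominated_loc_of_deriv_le (μ := F) (x₀ := (0 : ℝ))
    (s := Set.univ)
    (F := fun z x : ℝ => Complex.exp (Complex.I * z * x) - 1)
    (F' := fun z x : ℝ => Complex.exp (Complex.I * z * x) * (Complex.I * x)) (bound := fun x => |x|)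
    univ_mem (.of_forall fun z => (by fun_prop : Continuous _).aestronglyMeasurable)
    (integrable_exp_sub_one hF 0)
    (by fun_prop : Continuous _).aestronglyMeasurable
    (.of_forall fun x z _ => by
      have : Complex.I * z * x = ((z * x : ℝ) : ℂ) * Complex.I := by push_cast; ring
      rw [norm_mul, this, Complex.norm_exp_ofReal_mul_I]
      simp) hF.abs
    (.of_forall fun x z _ => by
      have h1 : HasDerivAt (fun z : ℝ => Complex.I * z * x) (Complex.I * x) z := by
        simpa using (((hasDerivAt_id z).ofReal_comp).const_mul Complex.I).mul_const (x : ℂ)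
      exact h1.cexp.sub_const 1)
  refine this.2.congr_deriv ?_
  simp only [Complex.ofReal_zero, mul_zero, zero_mul, Complex.exp_zero, one_mul]
  rw [integral_const_mul, integral_complex_ofReal]

end Exponent

/-! ### Moments of symmetric infinitely divisible laws -/

section Symmetrized

/-- The bounded approximation `2 sin (t x / 2) / t` of `x`, for small `t`. -/
noncomputable def sineApprox (t x : ℝ) : ℝ := 2 * Real.sin (t * x / 2) / t

lemma continuous_sineApprox (t : ℝ) : Continuous (sineApprox t) := by
  unfold sineApprox
  fun_prop

lemma two_sub_two_mul_cos (t x : ℝ) :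
    2 - 2 * Real.cos (t * x) = (2 * Real.sin (t * x / 2)) ^ 2 := by
  rw [mul_pow, Real.sin_sq_eq_half_sub, show 2 * (t * x / 2) = t * x by ring]
  ring

lemma sineApprox_sq {t : ℝ} (x : ℝ) :
    sineApprox t x ^ 2 = (2 - 2 * Real.cos (t * x)) / t ^ 2 := by
  rw [two_sub_two_mul_cos, sineApprox, div_pow]

lemma two_sub_two_mul_cos_nonneg (t x : ℝ) : 0 ≤ 2 - 2 * Real.cos (t * x) := by
  rw [two_sub_two_mul_cos]; positivity

lemma two_sub_two_mul_cos_le (t x : ℝ) : 2 - 2 * Real.cos (t * x) ≤ t ^ 2 * x ^ 2 := by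
  linarith [Real.one_sub_sq_div_two_le_cos (x := t * x), mul_pow t x 2]

lemma sineApprox_sq_le {t : ℝ} (ht : t ≠ 0) (x : ℝ) : sineApprox t x ^ 2 ≤ x ^ 2 := by
  rw [sineApprox_sq, div_le_iff₀ (by positivity), mul_comm (x ^ 2)]
  exact two_sub_two_mul_cos_le t x

lemma tendsto_sineApprox (x : ℝ) : Tendsto (fun t => sineApprox t x) (𝓝[≠] 0) (𝓝 x) := by
  have h : HasDerivAt (fun t : ℝ => 2 * Real.sin (t * x / 2)) x 0 := by
    have := ((((hasDerivAt_id (0 : ℝ)).mul_const x).div_const 2).sin).const_mul 2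
    refine this.congr_deriv ?_
    simp
    ring
  have := h.tendsto_slope
  refine this.congr fun t => ?_
  simp [slope, sineApprox]
  ring

lemma integrable_two_sub_two_mul_cos {F : Measure ℝ} (h2 : Integrable (fun x => x ^ 2) F) (t : ℝ) :
    Integrable (fun x => 2 - 2 * Real.cos (t * x)) F :=
  (h2.const_mul (t ^ 2)).mono' (by fun_prop : Continuous _).aestronglyMeasurable
    (.of_forall fun x => by
      rw [Real.norm_eq_abs, abs_of_nonneg (two_sub_two_mul_cos_nonneg t x)]
      exact two_sub_two_mul_cos_le t x)

lemma tendsto_integral_sineApprox_sq {F : Measure ℝ} (h2 : Integrable (fun x => x ^ 2) F) :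
    Tendsto (fun t => ∫ x, sineApprox t x ^ 2 ∂F) (𝓝[≠] 0) (𝓝 (∫ x, x ^ 2 ∂F)) := by
  refine tendsto_integral_filter_of_dominated_convergence (fun x => x ^ 2)
    (.of_forall fun t => ((continuous_sineApprox t).pow 2).aestronglyMeasurable) ?_ h2
    (.of_forall fun x => (tendsto_sineApprox x).pow 2)
  filter_upwards [self_mem_nhdsWithin] with t ht
  refine .of_forall fun x => ?_
  rw [Real.norm_eq_abs, abs_of_nonneg (sq_nonneg _)]
  exact sineApprox_sq_le ht x

lemma abs_exp_neg_sub_quadratic_le {q : ℝ} (h0 : 0 ≤ q) (h1 : q ≤ 1) :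
    |Real.exp (-q) - (1 - q + q ^ 2 / 2)| ≤ 2 / 9 * q ^ 3 := by
  have := Real.exp_bound (x := -q) (by rwa [abs_neg, abs_of_nonneg h0]) (n := 3) (by norm_num)
  rw [abs_neg, abs_of_nonneg h0] at this
  norm_num [Finset.sum_range_succ, Nat.factorial] at this
  convert this using 1
  · congr 1
  · ring

variable {s F : Measure ℝ} [IsProbabilityMeasure s] {h : ℝ}

/-- The variance of a law with characteristic function `exp (-h ∫ (2 - 2 cos (t x)) F(dx))`, i.e.
of the symmetrization of an infinitely divisible law with Lévy measure `h F`. -/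
lemma integral_sq_of_cos_eq (hh : 0 ≤ h) (F2 : Integrable (fun x => x ^ 2) F)
    (hs : ∀ t, ∫ x, Real.cos (t * x) ∂s = Real.exp (-(h * ∫ x, (2 - 2 * Real.cos (t * x)) ∂F)))
    (s2 : Integrable (fun x => x ^ 2) s) :
    ∫ x, x ^ 2 ∂s = 2 * h * ∫ x, x ^ 2 ∂F := by
  have hs2 := tendsto_integral_sineApprox_sq s2
  have hF2 := tendsto_integral_sineApprox_sq F2
  set R : ℝ → ℝ := fun t => h * ∫ x, sineApprox t x ^ 2 ∂F with hR
  have hRl : Tendsto R (𝓝[≠] 0) (𝓝 (h * ∫ x, x ^ 2 ∂F)) := hF2.const_mul h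
  have hR0 : ∀ t, 0 ≤ R t := fun t => mul_nonneg hh (integral_nonneg fun x => sq_nonneg _)
  have hid : ∀ t, t ≠ 0 →
      ∫ x, sineApprox t x ^ 2 ∂s = (2 - 2 * Real.exp (-(t ^ 2 * R t))) / t ^ 2 := by
    intro t ht
    have e1 : t ^ 2 * R t = h * ∫ x, (2 - 2 * Real.cos (t * x)) ∂F := by
      simp only [hR, sineApprox_sq]
      rw [integral_div]
      field_simp
    simp only [sineApprox_sq]
    rw [e1, ← hs, integral_div, integral_sub (integrable_const _), integral_const_mul]
    · simp
    · refine Integrable.const_mul (Integrable.of_bound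
        (by fun_prop : Continuous _).aestronglyMeasurable 1 (.of_forall fun x => ?_)) 2
      exact Real.abs_cos_le_one _
  have ht2 : Tendsto (fun t : ℝ => t ^ 2) (𝓝[≠] 0) (𝓝 0) := by
    have : Tendsto (fun t : ℝ => t ^ 2) (𝓝 0) (𝓝 (0 ^ 2)) := (continuous_pow 2).tendsto 0
    simp only [ne_eq, OfNat.ofNat_ne_zero, not_false_eq_true, zero_pow] at this
    exact this.mono_left nhdsWithin_le_nhds
  have hlim : Tendsto (fun t => ∫ x, sineApprox t x ^ 2 ∂s) (𝓝[≠] 0)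
      (𝓝 (2 * (h * ∫ x, x ^ 2 ∂F))) := by
    -- `2 q - 2 q² ≤ 2 - 2 exp (-q) ≤ 2 q` for `0 ≤ q ≤ 1`, with `q = t² R t`
    have hlow : Tendsto (fun t => 2 * R t - 2 * (t ^ 2 * R t ^ 2)) (𝓝[≠] 0)
        (𝓝 (2 * (h * ∫ x, x ^ 2 ∂F))) := by
      have := (hRl.const_mul 2).sub ((ht2.mul (hRl.pow 2)).const_mul 2)
      simpa using this
    have hsmall : ∀ᶠ t in 𝓝[≠] (0 : ℝ), t ^ 2 * R t < 1 := by
      have := ht2.mul hRl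
      rw [zero_mul] at this
      exact this.eventually (gt_mem_nhds one_pos)
    refine tendsto_of_tendsto_of_tendsto_of_le_of_le' hlow (hRl.const_mul 2) ?_ ?_
    · filter_upwards [self_mem_nhdsWithin, hsmall] with t ht h1
      have ht' : t ≠ 0 := ht
      rw [hid t ht, le_div_iff₀ (by positivity)]
      have hq0 : 0 ≤ t ^ 2 * R t := mul_nonneg (sq_nonneg _) (hR0 t)
      have := (abs_le.mp (abs_exp_neg_sub_quadratic_le hq0 h1.le)).2
      have h3 : (t ^ 2 * R t) ^ 3 ≤ (t ^ 2 * R t) ^ 2 :=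
        pow_le_pow_of_le_one hq0 h1.le (by norm_num)
      nlinarith [sq_nonneg (t ^ 2 * R t)]
    · filter_upwards [self_mem_nhdsWithin] with t ht
      have ht' : t ≠ 0 := ht
      rw [hid t ht, div_le_iff₀ (by positivity)]
      have := Real.add_one_le_exp (-(t ^ 2 * R t))
      linarith
  rw [tendsto_nhds_unique hs2 hlim]
  ring

/-- A symmetric infinitely divisible law has a finite fourth moment if its Lévy measure has
one. Since `(2 - 2 cos y)² = 6 - 8 cos y + 2 cos (2 y)`, the characteristic function determines the
expectation of the square of `2 - 2 cos (t x)`. It suffices to bound the expectation of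
`(2 - 2 cos (t x))² / t⁴`, by Fatou's lemma. -/
lemma integral_pow_four_le_of_cos_eq (hh : 0 ≤ h) (F2 : Integrable (fun x => x ^ 2) F)
    (F4 : Integrable (fun x => x ^ 4) F)
    (hs : ∀ t, ∫ x, Real.cos (t * x) ∂s = Real.exp (-(h * ∫ x, (2 - 2 * Real.cos (t * x)) ∂F))) :
    Integrable (fun x => x ^ 4) s ∧
      ∫ x, x ^ 4 ∂s ≤ 2 * h * ∫ x, x ^ 4 ∂F + 12 * h ^ 2 * (∫ x, x ^ 2 ∂F) ^ 2 := by
  set κ2 := ∫ x, x ^ 2 ∂F with hκ2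
  set κ4 := ∫ x, x ^ 4 ∂F with hκ4
  have hκ20 : 0 ≤ κ2 := integral_nonneg fun x => sq_nonneg _
  have hκ40 : 0 ≤ κ4 := integral_nonneg fun x => by positivity
  set Q : ℝ → ℝ := fun t => h * ∫ x, (2 - 2 * Real.cos (t * x)) ∂F with hQ
  have hQ0 : ∀ t, 0 ≤ Q t := fun t =>
    mul_nonneg hh (integral_nonneg fun x => two_sub_two_mul_cos_nonneg t x)
  have hQle : ∀ t, Q t ≤ h * κ2 * t ^ 2 := by
    intro t
    rw [hκ2, mul_assoc, ← integral_mul_const]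
    refine mul_le_mul_of_nonneg_left (integral_mono (integrable_two_sub_two_mul_cos F2 t)
      (F2.mul_const _) fun x => ?_) hh
    simp only
    rw [mul_comm (x ^ 2)]
    exact two_sub_two_mul_cos_le t x
  have hcos2 : ∀ t x : ℝ, Real.cos (2 * t * x) = 2 * Real.cos (t * x) ^ 2 - 1 := by
    intro t x
    rw [mul_assoc, Real.cos_two_mul]
  have hQ2 : ∀ t, Q (2 * t) ≤ 4 * Q t := by
    intro t
    simp only [hQ]
    rw [mul_left_comm, ← integral_const_mul 4]
    refine mul_le_mul_of_nonneg_left (integral_mono (integrable_two_sub_two_mul_cos F2 _)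
      ((integrable_two_sub_two_mul_cos F2 t).const_mul 4) fun x => ?_) hh
    simp only
    rw [hcos2]
    nlinarith [sq_nonneg (Real.cos (t * x) - 1)]
  have hQ4 : ∀ t, 8 * Q t - 2 * Q (2 * t) ≤ 2 * h * κ4 * t ^ 4 := by
    intro t
    have e : 8 * Q t - 2 * Q (2 * t) = h * ∫ x, (8 * (2 - 2 * Real.cos (t * x)) -
        2 * (2 - 2 * Real.cos (2 * t * x))) ∂F := by
      rw [integral_sub ((integrable_two_sub_two_mul_cos F2 t).const_mul 8)
        ((integrable_two_sub_two_mul_cos F2 (2 * t)).const_mul 2), integral_const_mul,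
        integral_const_mul]
      ring
    rw [e, hκ4, show 2 * h * (∫ x, x ^ 4 ∂F) * t ^ 4 = h * ((2 * t ^ 4) * ∫ x, x ^ 4 ∂F) by ring,
      ← integral_const_mul (2 * t ^ 4)]
    refine mul_le_mul_of_nonneg_left (integral_mono
      (((integrable_two_sub_two_mul_cos F2 t).const_mul 8).sub
        ((integrable_two_sub_two_mul_cos F2 (2 * t)).const_mul 2)) (F4.const_mul _) fun x => ?_) hh
    simp only
    rw [hcos2]
    have := pow_le_pow_left₀ (two_sub_two_mul_cos_nonneg t x) (two_sub_two_mul_cos_le t x) 2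
    nlinarith
  have icos : ∀ t : ℝ, Integrable (fun x => Real.cos (t * x)) s := fun t =>
    Integrable.of_bound (by fun_prop : Continuous _).aestronglyMeasurable 1
      (.of_forall fun x => Real.abs_cos_le_one _)
  -- the expectation of the fourth power of the approximation
  have hfour : ∀ t, t ≠ 0 → 4 * (h * κ2 * t ^ 2) ≤ 1 → ∫ x, sineApprox t x ^ 4 ∂s ≤
      2 * h * κ4 + 12 * h ^ 2 * κ2 ^ 2 + 64 * (h * κ2) ^ 3 * t ^ 2 := by
    intro t ht hsmall
    have j : Integrable (fun x => 6 - 8 * Real.cos (t * x)) s :=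
      (integrable_const _).sub ((icos t).const_mul 8)
    have e : ∫ x, sineApprox t x ^ 4 ∂s =
        (6 - 8 * Real.exp (-Q t) + 2 * Real.exp (-Q (2 * t))) / t ^ 4 := by
      simp only [hQ]
      rw [← hs, ← hs, ← integral_const_mul, ← integral_const_mul,
        show (6 : ℝ) - ∫ x, 8 * Real.cos (t * x) ∂s = ∫ x, (6 - 8 * Real.cos (t * x)) ∂s by
          rw [integral_sub (integrable_const _) ((icos t).const_mul 8)]; simp,
        ← integral_add j ((icos (2 * t)).const_mul 2), ← integral_div]
      refine integral_congr_ae (.of_forall fun x => ?_)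
      simp only
      rw [show sineApprox t x ^ 4 = (sineApprox t x ^ 2) ^ 2 by ring, sineApprox_sq, hcos2]
      field_simp
      ring
    have hle := hQle t
    have hq1 : Q t ≤ 1 := by linarith [hQ0 t]
    have hq2 : Q (2 * t) ≤ 1 := by linarith [hQ2 t]
    have b1 := (abs_le.mp (abs_exp_neg_sub_quadratic_le (hQ0 t) hq1)).1
    have b2 := (abs_le.mp (abs_exp_neg_sub_quadratic_le (hQ0 (2 * t)) hq2)).2
    have b3 := hQ4 t
    have b4 : Q (2 * t) ^ 2 ≤ 16 * Q t ^ 2 := by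
      have := pow_le_pow_left₀ (hQ0 (2 * t)) (hQ2 t) 2
      nlinarith
    have b5 : Q (2 * t) ^ 3 ≤ 64 * Q t ^ 3 := by
      have := pow_le_pow_left₀ (hQ0 (2 * t)) (hQ2 t) 3
      nlinarith
    have b6 : Q t ^ 2 ≤ (h * κ2) ^ 2 * t ^ 4 := by
      have := pow_le_pow_left₀ (hQ0 t) hle 2
      nlinarith
    have b7 : Q t ^ 3 ≤ (h * κ2) ^ 3 * t ^ 6 := by
      have := pow_le_pow_left₀ (hQ0 t) hle 3
      nlinarith
    have b8 : 0 ≤ Q t ^ 3 := pow_nonneg (hQ0 t) 3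
    have ht4 : 0 < t ^ 4 := by positivity
    rw [e, div_le_iff₀ ht4]
    have : (2 * h * κ4 + 12 * h ^ 2 * κ2 ^ 2 + 64 * (h * κ2) ^ 3 * t ^ 2) * t ^ 4 =
        2 * h * κ4 * t ^ 4 + 12 * ((h * κ2) ^ 2 * t ^ 4) + 64 * ((h * κ2) ^ 3 * t ^ 6) := by ring
    rw [this]
    linarith
  have i4 : ∀ t, t ≠ 0 → Integrable (fun x => sineApprox t x ^ 4) s := by
    intro t ht
    refine Integrable.of_bound ((continuous_sineApprox t).pow 4).aestronglyMeasurable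
      ((4 / t ^ 2) ^ 2) (.of_forall fun x => ?_)
    rw [Real.norm_eq_abs, abs_of_nonneg (by positivity),
      show sineApprox t x ^ 4 = (sineApprox t x ^ 2) ^ 2 by ring, sineApprox_sq]
    have := two_sub_two_mul_cos_nonneg t x
    gcongr
    linarith [Real.neg_one_le_cos (t * x)]
  have ht2 : Tendsto (fun t : ℝ => t ^ 2) (𝓝[≠] 0) (𝓝 0) := by
    have : Tendsto (fun t : ℝ => t ^ 2) (𝓝 0) (𝓝 (0 ^ 2)) := (continuous_pow 2).tendsto 0
    simp only [ne_eq, OfNat.ofNat_ne_zero, not_false_eq_true, zero_pow] at this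
    exact this.mono_left nhdsWithin_le_nhds
  have hsm : ∀ᶠ t in 𝓝[≠] (0 : ℝ), 4 * (h * κ2 * t ^ 2) ≤ 1 := by
    have := (ht2.const_mul (h * κ2)).const_mul 4
    simp only [mul_zero] at this
    exact (this.eventually (gt_mem_nhds one_pos)).mono fun t ht => ht.le
  have hM0 : 0 ≤ 2 * h * κ4 + 12 * h ^ 2 * κ2 ^ 2 := by positivity
  have hfatou : ∫⁻ x, ENNReal.ofReal (x ^ 4) ∂s ≤
      ENNReal.ofReal (2 * h * κ4 + 12 * h ^ 2 * κ2 ^ 2) := by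
    have e : ∀ x : ℝ, ENNReal.ofReal (x ^ 4) =
        liminf (fun t => ENNReal.ofReal (sineApprox t x ^ 4)) (𝓝[≠] 0) := fun x =>
      (ENNReal.tendsto_ofReal ((tendsto_sineApprox x).pow 4)).liminf_eq.symm
    rw [lintegral_congr e]
    refine (lintegral_liminf_le (f := fun t x => ENNReal.ofReal (sineApprox t x ^ 4))
      fun t => ENNReal.measurable_ofReal.comp
      ((continuous_sineApprox t).pow 4).measurable).trans ?_
    have hlim : Tendsto (fun t : ℝ => ENNReal.ofReal
        (2 * h * κ4 + 12 * h ^ 2 * κ2 ^ 2 + 64 * (h * κ2) ^ 3 * t ^ 2)) (𝓝[≠] 0)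
        (𝓝 (ENNReal.ofReal (2 * h * κ4 + 12 * h ^ 2 * κ2 ^ 2))) := by
      refine ENNReal.tendsto_ofReal ?_
      have := (ht2.const_mul (64 * (h * κ2) ^ 3)).const_add
        (2 * h * κ4 + 12 * h ^ 2 * κ2 ^ 2)
      rwa [mul_zero, add_zero] at this
    rw [← hlim.liminf_eq]
    refine liminf_le_liminf ?_
    filter_upwards [self_mem_nhdsWithin, hsm] with t ht h1
    rw [← ofReal_integral_eq_lintegral_ofReal (i4 t ht) (.of_forall fun x => by
      simp only [Pi.zero_apply]; positivity)]
    exact ENNReal.ofReal_le_ofReal (hfour t ht h1)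
  have hint : Integrable (fun x : ℝ => x ^ 4) s := by
    refine ⟨(by fun_prop : Continuous _).aestronglyMeasurable, ?_⟩
    rw [hasFiniteIntegral_iff_ofReal (.of_forall fun x => by simp only [Pi.zero_apply]; positivity)]
    exact hfatou.trans_lt ENNReal.ofReal_lt_top
  refine ⟨hint, ?_⟩
  rw [← ofReal_integral_eq_lintegral_ofReal hint (.of_forall fun x => by
    simp only [Pi.zero_apply]; positivity)] at hfatou
  exact (ENNReal.ofReal_le_ofReal_iff hM0).mp hfatou

end Symmetrized

/-! ### Symmetrization -/

/-- The law of `Y - Y'` for independent `Y`, `Y'` of law `ξ`. -/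
noncomputable def symmetrized (ξ : Measure ℝ) : Measure ℝ := ξ.conv (ξ.map fun x => -x)

section

variable {ξ : Measure ℝ} [IsProbabilityMeasure ξ]

instance isProbabilityMeasure_map_neg : IsProbabilityMeasure (ξ.map fun x => -x) :=
  Measure.isProbabilityMeasure_map (by fun_prop)

instance isProbabilityMeasure_symmetrized : IsProbabilityMeasure (symmetrized ξ) := by
  unfold symmetrized
  infer_instance

lemma charFun_map_neg (ξ : Measure ℝ) (t : ℝ) :
    charFun (ξ.map fun x => -x) t = charFun ξ (-t) := by
  have := charFun_map_mul (μ := ξ) (-1) t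
  simpa using this

lemma charFun_symmetrized (ξ : Measure ℝ) [IsProbabilityMeasure ξ] (t : ℝ) :
    charFun (symmetrized ξ) t = ((‖charFun ξ t‖ ^ 2 : ℝ) : ℂ) := by
  rw [symmetrized, charFun_conv, charFun_map_neg, charFun_neg, Complex.mul_conj,
    Complex.normSq_eq_norm_sq]

lemma re_charFun (η : Measure ℝ) [IsProbabilityMeasure η] (t : ℝ) :
    (charFun η t).re = ∫ x, Real.cos (t * x) ∂η := by
  have hi : Integrable (fun x : ℝ => Complex.exp (t * x * Complex.I)) η := by
    refine Integrable.of_bound (by fun_prop : Continuous _).aestronglyMeasurable 1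
      (.of_forall fun x => ?_)
    have : (t * x * Complex.I : ℂ) = ((t * x : ℝ) : ℂ) * Complex.I := by push_cast; ring
    rw [this, Complex.norm_exp_ofReal_mul_I]
  rw [charFun_apply_real]
  have h := (Complex.reCLM.integral_comp_comm hi).symm
  simp only [Complex.reCLM_apply] at h
  rw [h]
  refine integral_congr_ae (.of_forall fun x => ?_)
  simp only
  have : (t * x * Complex.I : ℂ) = ((t * x : ℝ) : ℂ) * Complex.I := by push_cast; ring
  rw [this, Complex.exp_ofReal_mul_I_re]

lemma integral_cos_symmetrized (t : ℝ) :
    ∫ x, Real.cos (t * x) ∂(symmetrized ξ) = ‖charFun ξ t‖ ^ 2 := by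
  rw [← re_charFun, charFun_symmetrized, Complex.ofReal_re]

lemma memLp_id_four_of_integrable {ν : Measure ℝ} (h : Integrable (fun x => x ^ 4) ν) :
    MemLp id 4 ν := by
  have := (integrable_norm_rpow_iff (f := (id : ℝ → ℝ)) (p := 4) (μ := ν)
    aestronglyMeasurable_id (by norm_num) (by norm_num)).mp
  apply this
  refine h.congr (.of_forall fun x => ?_)
  have : ‖x‖ ^ (4 : ℝ) = ‖x‖ ^ 4 := by exact_mod_cast Real.rpow_natCast ‖x‖ 4
  simp only [id, ENNReal.toReal_ofNat]
  rw [this, Real.norm_eq_abs, Even.pow_abs (by decide : Even 4)]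

/-- A law whose symmetrization has a fourth moment has one itself. -/
lemma memLp_four_of_symmetrized (h : Integrable (fun x => x ^ 4) (symmetrized ξ)) :
    MemLp id 4 ξ := by
  rw [symmetrized, Measure.conv_comm,
    integrable_conv_iff (by fun_prop : Continuous _).aestronglyMeasurable] at h
  obtain ⟨a, ha⟩ := h.1.exists
  have h1 : Integrable (fun y => y ^ 4) (ξ.map (a + ·)) := by
    rw [integrable_map_measure (by fun_prop : Continuous _).aestronglyMeasurable (by fun_prop)]
    exact ha
  have h2 := memLp_id_four_of_integrable h1
  rw [memLp_map_measure_iff aestronglyMeasurable_id (by fun_prop)] at h2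
  have h3 := h2.sub (memLp_const a)
  refine (memLp_congr_ae (.of_forall fun x => ?_)).mp h3
  simp

lemma integral_symmetrized {f : ℝ → ℝ} (hf : Continuous f) (hi : Integrable f (symmetrized ξ)) :
    ∫ x, f x ∂(symmetrized ξ) = ∫ x, ∫ y, f (x - y) ∂ξ ∂ξ := by
  rw [symmetrized, integral_conv hi]
  refine integral_congr_ae (.of_forall fun x => ?_)
  simp only
  rw [integral_map (by fun_prop) (by fun_prop : Continuous _).aestronglyMeasurable]
  rfl

lemma memLp_symmetrized {p : ℝ≥0∞} (h : MemLp id p ξ) :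
    MemLp id p (symmetrized ξ) := by
  have hn : MemLp id p (ξ.map fun x => -x) := by
    rw [memLp_map_measure_iff aestronglyMeasurable_id (by fun_prop)]
    exact h.neg
  rw [symmetrized, Measure.conv, memLp_map_measure_iff aestronglyMeasurable_id (by fun_prop)]
  exact (h.comp_fst _).add (hn.comp_snd _)

lemma integral_sq_symmetrized (h : MemLp id 2 ξ) :
    ∫ x, x ^ 2 ∂(symmetrized ξ) = 2 * ∫ x, (x - ∫ y, y ∂ξ) ^ 2 ∂ξ := by
  have i1 : Integrable (fun x : ℝ => x) ξ := h.integrable (by norm_num)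
  have i2 : Integrable (fun x : ℝ => x ^ 2) ξ := h.integrable_sq
  have e : ∀ a : ℝ, ∫ y, (y - a) ^ 2 ∂ξ = ∫ y, y ^ 2 ∂ξ - 2 * a * ∫ y, y ∂ξ + a ^ 2 := by
    intro a
    have : ∀ y : ℝ, (y - a) ^ 2 = y ^ 2 - 2 * a * y + a ^ 2 := fun y => by ring
    simp_rw [this]
    have j : Integrable (fun y : ℝ => y ^ 2 - 2 * a * y) ξ := i2.sub (i1.const_mul _)
    rw [integral_add j (integrable_const _), integral_sub i2 (i1.const_mul _), integral_const_mul]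
    simp
  rw [integral_symmetrized (f := fun x => x ^ 2) (by fun_prop)
    (memLp_symmetrized h).integrable_sq, e]
  have e2 : ∀ x : ℝ, ∫ y, (x - y) ^ 2 ∂ξ = ∫ y, y ^ 2 ∂ξ - 2 * (∫ y, y ∂ξ) * x + x ^ 2 := by
    intro x
    rw [mul_right_comm, ← e]
    refine integral_congr_ae (.of_forall fun y => ?_)
    simp only
    ring
  simp_rw [e2]
  have j : Integrable (fun x : ℝ => ∫ y, y ^ 2 ∂ξ - 2 * (∫ y, y ∂ξ) * x) ξ :=
    (integrable_const _).sub (i1.const_mul _)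
  rw [integral_add j i2, integral_sub (integrable_const _) (i1.const_mul _), integral_const_mul]
  simp
  ring

/-- Jensen's inequality: centring at the mean is better than centring at an independent copy. -/
lemma integral_abs_sub_mean_pow_three_le (h : MemLp id 3 ξ) :
    ∫ x, |x - ∫ y, y ∂ξ| ^ 3 ∂ξ ≤ ∫ x, |x| ^ 3 ∂(symmetrized ξ) := by
  set m := ∫ y, y ∂ξ with hm
  have i1 : Integrable (fun x : ℝ => x) ξ := h.integrable (by norm_num)
  have hs := integrable_abs_pow_three (memLp_symmetrized h)
  have i3 : ∀ x : ℝ, Integrable (fun y => |x - y| ^ 3) ξ := by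
    intro x
    have h1 : MemLp id 3 (ξ.map (x - ·)) := by
      rw [memLp_map_measure_iff aestronglyMeasurable_id (by fun_prop)]
      exact (memLp_const x).sub h
    exact (integrable_abs_pow_three h1).comp_measurable (by fun_prop)
  -- the tangent inequality for the convex function `|·|³`
  have htan : ∀ a b : ℝ, |a| ^ 3 + 3 * (a * |a|) * (b - a) ≤ |b| ^ 3 := by
    intro a b
    rcases abs_cases a with ⟨ha, ha'⟩ | ⟨ha, ha'⟩ <;>
    rcases abs_cases b with ⟨hb, hb'⟩ | ⟨hb, hb'⟩ <;>
      rw [ha, hb]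
    · nlinarith [mul_nonneg ha' (sq_nonneg (b - a)), mul_nonneg hb' (sq_nonneg (b - a))]
    · have h1 : 0 ≤ a ^ 3 := by positivity
      have h2 : 0 ≤ (-b) ^ 3 := by have : 0 ≤ -b := by linarith
                                   positivity
      nlinarith [mul_nonneg (sq_nonneg a) (by linarith : 0 ≤ -b)]
    · have h1 : 0 ≤ (-a) ^ 3 := by have : 0 ≤ -a := by linarith
                                   positivity
      have h2 : 0 ≤ b ^ 3 := by positivity
      nlinarith [mul_nonneg (sq_nonneg a) hb']
    · nlinarith [mul_nonneg (by linarith : 0 ≤ -a) (sq_nonneg (b - a)),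
        mul_nonneg (by linarith : 0 ≤ -b) (sq_nonneg (b - a))]
  rw [integral_symmetrized (by fun_prop) hs]
  refine integral_mono_of_nonneg (.of_forall fun x => by simp only [Pi.zero_apply]; positivity) ?_
    (.of_forall fun x => ?_)
  · rw [symmetrized, Measure.conv, integrable_map_measure
      (by fun_prop : Continuous _).aestronglyMeasurable (by fun_prop)] at hs
    have := hs.integral_prod_left
    refine this.congr (.of_forall fun x => ?_)
    simp only [Function.comp]
    rw [integral_map (by fun_prop) (by fun_prop : Continuous _).aestronglyMeasurable]
    rfl
  · simp only
    have e : ∫ y, (|x - m| ^ 3 + 3 * ((x - m) * |x - m|) * ((x - y) - (x - m))) ∂ξ =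
        |x - m| ^ 3 := by
      have : ∀ y, |x - m| ^ 3 + 3 * ((x - m) * |x - m|) * ((x - y) - (x - m)) =
          (|x - m| ^ 3 + 3 * ((x - m) * |x - m|) * m) - 3 * ((x - m) * |x - m|) * y :=
        fun y => by ring
      simp_rw [this]
      rw [integral_sub (integrable_const _) (i1.const_mul _), integral_const_mul, ← hm]
      simp
    rw [← e]
    refine integral_mono ?_ (i3 x) fun y => htan _ _
    refine (integrable_const _).add (Integrable.const_mul ?_ _)
    exact ((integrable_const x).sub i1).sub (integrable_const _)

lemma integral_abs_pow_three_conv_le {s s' : Measure ℝ} [IsProbabilityMeasure s]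
    [IsProbabilityMeasure s'] (h : MemLp id 3 s) (h' : MemLp id 3 s') :
    ∫ x, |x| ^ 3 ∂(s.conv s') ≤ 4 * (∫ x, |x| ^ 3 ∂s + ∫ x, |x| ^ 3 ∂s') := by
  have i := integrable_abs_pow_three h
  have i' := integrable_abs_pow_three h'
  have hc : MemLp id 3 (s.conv s') := by
    rw [Measure.conv, memLp_map_measure_iff aestronglyMeasurable_id (by fun_prop)]
    exact (h.comp_fst _).add (h'.comp_snd _)
  have ic := integrable_abs_pow_three hc
  rw [Measure.conv, integrable_map_measure
      (by fun_prop : Continuous _).aestronglyMeasurable (by fun_prop)] at ic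
  rw [Measure.conv, integral_map (by fun_prop) (by fun_prop : Continuous _).aestronglyMeasurable]
  have j : Integrable (fun p : ℝ × ℝ => 4 * (|p.1| ^ 3 + |p.2| ^ 3)) (s.prod s') :=
    ((i.comp_fst s').add (i'.comp_snd s)).const_mul 4
  refine (integral_mono ic j fun p => ?_).trans (le_of_eq ?_)
  · simp only [Function.comp]
    have h1 : |p.1 + p.2| ^ 3 ≤ (|p.1| + |p.2|) ^ 3 := by
      gcongr
      exact abs_add_le _ _
    nlinarith [mul_nonneg (add_nonneg (abs_nonneg p.1) (abs_nonneg p.2))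
      (sq_nonneg (|p.1| - |p.2|))]
  · rw [integral_const_mul, integral_add (i.comp_fst s') (i'.comp_snd s),
      integral_fun_fst (fun x : ℝ => |x| ^ 3), integral_fun_snd (fun x : ℝ => |x| ^ 3)]
    simp

end

/-! ### Moments of tempered stable laws and of their convolution roots -/

section Roots

variable {α β lam : ℝ}

lemma integrable_id_oneSidedLevyMeasure (hα : 0 < α) (hβ : β < 1) (hlam : 0 < lam) :
    Integrable (fun x : ℝ => x) (oneSidedLevyMeasure α β lam) := by
  simpa using integrable_pow_oneSidedLevyMeasure hα hβ hlam le_rfl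

/-- Taking the `N`-th convolution root divides the exponent of the modulus of the characteristic
function. -/
lemma norm_charFun_sq_of_sumLaw {ξ : Measure ℝ} [IsProbabilityMeasure ξ] {N : ℕ} (hN : 0 < N)
    {t q : ℝ} (h : ‖charFun (sumLaw ξ N) t‖ ^ 2 = Real.exp (-q)) :
    ‖charFun ξ t‖ ^ 2 = Real.exp (-((1 / N : ℝ) * q)) := by
  have hN0 : (N : ℝ) ≠ 0 := by positivity
  rw [charFun_sumLaw, norm_pow, ← pow_mul, mul_comm, pow_mul] at h
  refine (pow_left_inj₀ (by positivity) (Real.exp_pos _).le hN.ne').mp ?_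
  rw [h, ← Real.exp_nat_mul]
  congr 1
  field_simp

lemma IsOneSidedTS.norm_charFun_sq (hα : 0 < α) (hβ : β < 1) (hlam : 0 < lam) {η : Measure ℝ}
    (hη : IsOneSidedTS α β lam η) (t : ℝ) :
    ‖charFun η t‖ ^ 2 =
      Real.exp (-∫ x, (2 - 2 * Real.cos (t * x)) ∂(oneSidedLevyMeasure α β lam)) := by
  rw [hη.2, norm_exp_integral_exp_sub_one_sq (integrable_id_oneSidedLevyMeasure hα hβ hlam)]

/-- The symmetrized `N`-th convolution root of a one-sided tempered stable law exists, and for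
large `N` its third absolute moment is at most `4 / N` times that of the Lévy measure. -/
lemma IsOneSidedTS.exists_root (hα : 0 < α) (hβ : β < 1) (hlam : 0 < lam)
    {η : Measure ℝ} (hη : IsOneSidedTS α β lam η) {N : ℕ} (hN : 0 < N)
    (hNlarge : 6 * levyMoment α β lam 2 ^ 3 ≤ N * levyMoment α β lam 3 ^ 2) :
    ∃ s : Measure ℝ, IsProbabilityMeasure s ∧ MemLp id 3 s ∧
      (∀ t, charFun s t = (Real.exp (-((1 / N : ℝ) *
        ∫ x, (2 - 2 * Real.cos (t * x)) ∂(oneSidedLevyMeasure α β lam))) : ℂ)) ∧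
      ∫ x, |x| ^ 3 ∂s ≤ 4 * (1 / N : ℝ) * levyMoment α β lam 3 := by
  obtain ⟨ν, hν, hroot⟩ := hη.1.2 N hN
  have hnorm : ∀ t, ‖charFun ν t‖ ^ 2 = Real.exp (-((1 / N : ℝ) *
      ∫ x, (2 - 2 * Real.cos (t * x)) ∂(oneSidedLevyMeasure α β lam))) := fun t => by
    refine norm_charFun_sq_of_sumLaw hN ?_
    rw [sumLaw, hroot, hη.norm_charFun_sq hα hβ hlam]
  have hN0 : (0 : ℝ) < N := by exact_mod_cast hN
  set h : ℝ := 1 / N with hh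
  have hh0 : 0 < h := by positivity
  have F2 := integrable_pow_oneSidedLevyMeasure hα hβ hlam (k := 2) (by norm_num)
  have F4 := integrable_pow_oneSidedLevyMeasure hα hβ hlam (k := 4) (by norm_num)
  have hcos : ∀ t, ∫ x, Real.cos (t * x) ∂(symmetrized ν) = Real.exp (-(h *
      ∫ x, (2 - 2 * Real.cos (t * x)) ∂(oneSidedLevyMeasure α β lam))) := fun t => by
    rw [integral_cos_symmetrized, hnorm]
  obtain ⟨i4, b4⟩ := integral_pow_four_le_of_cos_eq hh0.le F2 F4 hcos
  have m4 := memLp_id_four_of_integrable i4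
  have i2 : Integrable (fun x => x ^ 2) (symmetrized ν) :=
    (m4.mono_exponent (by norm_num)).integrable_sq
  have m3 : MemLp id 3 (symmetrized ν) := m4.mono_exponent (by norm_num)
  have b2 := integral_sq_of_cos_eq hh0.le F2 hcos i2
  refine ⟨symmetrized ν, inferInstance, m3, fun t => ?_, ?_⟩
  · rw [charFun_symmetrized, hnorm]
  have p2 := levyMoment_pos hα hβ hlam (k := 2) (by norm_num)
  have p3 := levyMoment_pos hα hβ hlam (k := 3) (by norm_num)
  have p4 := levyMoment_pos hα hβ hlam (k := 4) (by norm_num)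
  have r2 := levyMoment_succ hα hβ hlam (k := 2) (by norm_num)
  have r3 := levyMoment_succ hα hβ hlam (k := 3) (by norm_num)
  rw [← levyMoment, ← levyMoment] at b4
  rw [← levyMoment] at b2
  norm_num at r2 r3
  set κ2 := levyMoment α β lam 2
  set κ3 := levyMoment α β lam 3
  set κ4 := levyMoment α β lam 4
  -- the third moment is interpolated between the second and the fourth one by the inequality
  -- `2 |x|³ ≤ r x² + x⁴ / r`, with `r` the ratio of the third and second cumulants
  set r := κ3 / κ2 with hr
  have hr0 : 0 < r := div_pos p3 p2
  have hinterp : ∫ x, |x| ^ 3 ∂(symmetrized ν) ≤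
      ∫ x, (r / 2 * x ^ 2 + 1 / (2 * r) * x ^ 4) ∂(symmetrized ν) := by
    refine integral_mono (integrable_abs_pow_three m3) ((i2.const_mul _).add (i4.const_mul _))
      fun x => ?_
    simp only
    have e4 : x ^ 4 = |x| ^ 4 := (Even.pow_abs (by decide : Even 4) x).symm
    have : r / 2 * x ^ 2 + 1 / (2 * r) * x ^ 4 - |x| ^ 3 =
        |x| ^ 2 * (r - |x|) ^ 2 / (2 * r) := by
      rw [e4, ← sq_abs x]
      field_simp
      ring
    have h0 : 0 ≤ |x| ^ 2 * (r - |x|) ^ 2 / (2 * r) := by positivity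
    linarith
  rw [integral_add (i2.const_mul _) (i4.const_mul _), integral_const_mul, integral_const_mul,
    b2] at hinterp
  have h24 : κ4 * κ2 ≤ 2 * κ3 ^ 2 := by
    have : κ4 * κ2 * (2 - β) = (3 - β) * κ3 ^ 2 := by
      have h1 : lam * (κ4 * κ2 * (2 - β)) = lam * ((3 - β) * κ3 ^ 2) := by
        linear_combination κ2 * (2 - β) * r3 - (3 - β) * κ3 * r2
      exact mul_left_cancel₀ hlam.ne' h1
    have h2 : (3 - β) * κ3 ^ 2 ≤ (2 * κ3 ^ 2) * (2 - β) := by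
      nlinarith [sq_nonneg κ3]
    exact le_of_mul_le_mul_right (this.trans_le h2) (by linarith)
  have hsm : 6 * h * κ2 ^ 3 ≤ κ3 ^ 2 := by
    rw [hh, mul_one_div, div_mul_eq_mul_div, div_le_iff₀ hN0]
    linarith
  calc ∫ x, |x| ^ 3 ∂(symmetrized ν)
      ≤ r / 2 * (2 * h * κ2) + 1 / (2 * r) * (2 * h * κ4 + 12 * h ^ 2 * κ2 ^ 2) := by
        refine hinterp.trans ?_
        gcongr
    _ = h * κ3 + h * (κ4 * κ2 + 6 * h * κ2 ^ 3) / κ3 := by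
        rw [hr]
        field_simp
        ring
    _ ≤ h * κ3 + h * (2 * κ3 ^ 2 + κ3 ^ 2) / κ3 := by gcongr
    _ = 4 * h * κ3 := by
        field_simp
        ring

end Roots

section TwoSided

variable {αp βp lp αm βm lm : ℝ}

lemma IsTS.isProbabilityMeasure {η : Measure ℝ} (hη : IsTS αp βp lp αm βm lm η) :
    IsProbabilityMeasure η := by
  obtain ⟨ηp, ν, hp, hm, rfl⟩ := hη
  have := hp.1.1
  have := hm.1.1
  infer_instance

/-- The mean of a two-sided tempered stable law, from the derivative of its characteristic
function at the origin. -/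
lemma IsTS.integral_id (hαp : 0 < αp) (hβp : βp < 1) (hlp : 0 < lp) (hαm : 0 < αm) (hβm : βm < 1)
    (hlm : 0 < lm) {η : Measure ℝ} (hη : IsTS αp βp lp αm βm lm η) (h1 : MemLp id 1 η) :
    ∫ x, x ∂η = levyMoment αp βp lp 1 - levyMoment αm βm lm 1 := by
  have := hη.isProbabilityMeasure
  obtain ⟨ηp, ν, hp, hm, rfl⟩ := hη
  have := hp.1.1
  have := hm.1.1
  have d1 : deriv (charFun (ηp.conv (ν.map fun x => -x))) 0 =
      Complex.I * ∫ x, x ∂(ηp.conv (ν.map fun x => -x)) := by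
    have := iteratedDeriv_charFun_zero (n := 1) (by exact_mod_cast h1)
    simpa using this
  have e : charFun (ηp.conv (ν.map fun x => -x)) = fun z : ℝ => Complex.exp
      (∫ x : ℝ, (Complex.exp (Complex.I * z * x) - 1) ∂(oneSidedLevyMeasure αp βp lp)) *
      Complex.exp (∫ x : ℝ, (Complex.exp (Complex.I * (-z : ℝ) * x) - 1)
        ∂(oneSidedLevyMeasure αm βm lm)) := by
    ext z
    rw [charFun_conv, charFun_map_neg, hp.2, hm.2]
  have a1 := hasDerivAt_integral_exp_sub_one (integrable_id_oneSidedLevyMeasure hαp hβp hlp)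
  have a2 := hasDerivAt_integral_exp_sub_one (integrable_id_oneSidedLevyMeasure hαm hβm hlm)
  rw [← neg_zero] at a2
  have a3 := (a2.scomp (0 : ℝ) (hasDerivAt_neg (0 : ℝ)))
  have d2 := (a1.cexp.mul a3.cexp).deriv
  have e2 : deriv (charFun (ηp.conv (ν.map fun x => -x))) 0 =
      Complex.I * ((∫ x, x ∂(oneSidedLevyMeasure αp βp lp) -
        ∫ x, x ∂(oneSidedLevyMeasure αm βm lm) : ℝ) : ℂ) := by
    rw [e]
    refine Eq.trans d2 ?_
    simp
    ring
  rw [e2] at d1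
  have := mul_left_cancel₀ Complex.I_ne_zero d1
  rw [levyMoment, levyMoment]
  simp only [pow_one]
  exact_mod_cast this.symm

/-- The first moments of the `N`-th convolution root of a two-sided tempered stable law. -/
lemma IsTS.moments_of_root (hαp : 0 < αp) (hβp : βp < 1) (hlp : 0 < lp) (hαm : 0 < αm)
    (hβm : βm < 1) (hlm : 0 < lm) {ξ : Measure ℝ} [IsProbabilityMeasure ξ] {N : ℕ} (hN : 0 < N)
    (hη : IsTS αp βp lp αm βm lm (sumLaw ξ N)) :
    MemLp id 4 ξ ∧
    ∫ x, (x - ∫ y, y ∂ξ) ^ 2 ∂ξ =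
      (1 / N : ℝ) * (levyMoment αp βp lp 2 + levyMoment αm βm lm 2) ∧
    (6 * levyMoment αp βp lp 2 ^ 3 ≤ N * levyMoment αp βp lp 3 ^ 2 →
      6 * levyMoment αm βm lm 2 ^ 3 ≤ N * levyMoment αm βm lm 3 ^ 2 →
      ∫ x, |x - ∫ y, y ∂ξ| ^ 3 ∂ξ ≤
        16 * (1 / N : ℝ) * (levyMoment αp βp lp 3 + levyMoment αm βm lm 3)) := by
  obtain ⟨ηp, ν, hp, hm, hconv⟩ := hη
  have := hp.1.1
  have := hm.1.1
  have hN0 : (0 : ℝ) < N := by exact_mod_cast hN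
  set Fp := oneSidedLevyMeasure αp βp lp with hFp
  set Fm := oneSidedLevyMeasure αm βm lm with hFm
  have ip : ∀ k, 1 ≤ k → Integrable (fun x => x ^ k) Fp := fun k hk =>
    integrable_pow_oneSidedLevyMeasure hαp hβp hlp hk
  have im : ∀ k, 1 ≤ k → Integrable (fun x => x ^ k) Fm := fun k hk =>
    integrable_pow_oneSidedLevyMeasure hαm hβm hlm hk
  have cp := integrable_two_sub_two_mul_cos (ip 2 (by norm_num))
  have cm := integrable_two_sub_two_mul_cos (im 2 (by norm_num))
  have hnorm : ∀ t, ‖charFun ξ t‖ ^ 2 = Real.exp (-((1 / N : ℝ) *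
      (∫ x, (2 - 2 * Real.cos (t * x)) ∂Fp + ∫ x, (2 - 2 * Real.cos (t * x)) ∂Fm))) := fun t => by
    refine norm_charFun_sq_of_sumLaw hN ?_
    rw [hconv, charFun_conv, charFun_map_neg, charFun_neg, norm_mul, RCLike.norm_conj, mul_pow,
      hp.norm_charFun_sq hαp hβp hlp, hm.norm_charFun_sq hαm hβm hlm, ← Real.exp_add]
    congr 1
    ring
  have hcos : ∀ t, ∫ x, Real.cos (t * x) ∂(symmetrized ξ) = Real.exp (-((1 / N : ℝ) *
      ∫ x, (2 - 2 * Real.cos (t * x)) ∂(Fp + Fm))) := fun t => by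
    rw [integral_cos_symmetrized, hnorm, integral_add_measure (cp t) (cm t)]
  have hh0 : (0 : ℝ) ≤ 1 / N := by positivity
  have F2 := (ip 2 (by norm_num)).add_measure (im 2 (by norm_num))
  have F4 := (ip 4 (by norm_num)).add_measure (im 4 (by norm_num))
  obtain ⟨i4, -⟩ := integral_pow_four_le_of_cos_eq hh0 F2 F4 hcos
  have m4 := memLp_four_of_symmetrized i4
  have m2 : MemLp id 2 ξ := m4.mono_exponent (by norm_num)
  have m3 : MemLp id 3 ξ := m4.mono_exponent (by norm_num)
  refine ⟨m4, ?_, fun hlp' hlm' => ?_⟩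
  · have b2 := integral_sq_of_cos_eq hh0 F2 hcos (memLp_symmetrized m2).integrable_sq
    have b3 := integral_sq_symmetrized m2
    rw [integral_add_measure (ip 2 (by norm_num)) (im 2 (by norm_num))] at b2
    rw [levyMoment, levyMoment, ← hFp, ← hFm]
    linarith
  · obtain ⟨sp, hsp, mp, ep, bp⟩ := hp.exists_root hαp hβp hlp hN hlp'
    obtain ⟨sm, hsm, mm, em, bm⟩ := hm.exists_root hαm hβm hlm hN hlm'
    -- the symmetrized root splits into the symmetrized roots of the two one-sided laws
    have hsplit : symmetrized ξ = sp.conv sm := by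
      apply Measure.ext_of_charFun
      ext t
      rw [charFun_symmetrized, hnorm, charFun_conv, ep, em, ← Complex.ofReal_mul, ← Real.exp_add]
      congr 2
      ring
    have := integral_abs_sub_mean_pow_three_le m3
    rw [hsplit] at this
    have h3 := integral_abs_pow_three_conv_le mp mm
    linarith

end TwoSided

/-! ### The rate in terms of cumulants -/

section Rate

variable {αp βp lp αm βm lm : ℝ}

/-- The explicit rate is the sum of the two third cumulants over `σ³ √t`, since these cumulants
can be recovered from the mean and the variance. -/
lemma rateBound_eq (hαp : 0 < αp) (hβp : βp < 1) (hlp : 0 < lp) (hαm : 0 < αm) (hβm : βm < 1)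
    (hlm : 0 < lm) {μ σ : ℝ} (hμ : μ = levyMoment αp βp lp 1 - levyMoment αm βm lm 1)
    (hσ : 0 < σ) (hσ2 : σ ^ 2 = levyMoment αp βp lp 2 + levyMoment αm βm lm 2) (t : ℝ) :
    rateBound βp lp βm lm μ σ t = 32 * berryEsseenConstant *
      ((levyMoment αp βp lp 3 + levyMoment αm βm lm 3) / σ ^ 3) / √t := by
  have p1 := levyMoment_succ hαp hβp hlp (k := 1) le_rfl
  have p2 := levyMoment_succ hαp hβp hlp (k := 2) (by norm_num)
  have m1 := levyMoment_succ hαm hβm hlm (k := 1) le_rfl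
  have m2 := levyMoment_succ hαm hβm hlm (k := 2) (by norm_num)
  norm_num at p1 p2 m1 m2
  set D := (1 - βm) * lp + (1 - βp) * lm with hD
  have hD0 : 0 < D :=
    add_pos (mul_pos (by linarith) hlp) (mul_pos (by linarith) hlm)
  have ep : (1 - βp) * ((1 - βm) * μ + lm * σ ^ 2) = levyMoment αp βp lp 2 * D := by
    rw [hσ2, hμ, hD]
    linear_combination -(1 - βm) * p1 + (1 - βp) * m1
  have em : (1 - βm) * ((βp - 1) * μ + lp * σ ^ 2) = levyMoment αm βm lm 2 * D := by
    rw [hσ2, hμ, hD]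
    linear_combination (1 - βm) * p1 - (1 - βp) * m1
  have tp : (1 - βp) * (2 - βp) * (((1 - βm) * μ / σ ^ 3 + lm / σ) / (lp * D)) =
      levyMoment αp βp lp 3 / σ ^ 3 := by
    have : (1 - βm) * μ / σ ^ 3 + lm / σ = ((1 - βm) * μ + lm * σ ^ 2) / σ ^ 3 := by
      field_simp
    rw [this, div_div, mul_div_assoc', div_eq_div_iff (by positivity) (by positivity)]
    linear_combination σ ^ 3 * (2 - βp) * ep - σ ^ 3 * D * p2
  have tm : (1 - βm) * (2 - βm) * (((βp - 1) * μ / σ ^ 3 + lp / σ) / (lm * D)) =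
      levyMoment αm βm lm 3 / σ ^ 3 := by
    have : (βp - 1) * μ / σ ^ 3 + lp / σ = ((βp - 1) * μ + lp * σ ^ 2) / σ ^ 3 := by
      field_simp
    rw [this, div_div, mul_div_assoc', div_eq_div_iff (by positivity) (by positivity)]
    linear_combination σ ^ 3 * (2 - βm) * em - σ ^ 3 * D * m2
  rw [rateBound, tp, tm]
  ring

end Rate

/-! ### Lévy processes -/

section Levy

variable {Ω : Type*} [MeasurableSpace Ω] {X : ℝ≥0 → Ω → ℝ} {P : Measure Ω}
  [IsProbabilityMeasure P]

lemma IsLevyProcess.isProbabilityMeasure_map (hX : IsLevyProcess X P) (t : ℝ≥0) :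
    IsProbabilityMeasure (P.map (X t)) :=
  Measure.isProbabilityMeasure_map (hX.measurable t).aemeasurable

lemma IsLevyProcess.map_add (hX : IsLevyProcess X P) (s h : ℝ≥0) :
    P.map (X (s + h)) = (P.map (X s)).conv (P.map (X h)) := by
  have hind := hX.indep.indepFun_eval_sub (s := s) (t := s + h) zero_le
    (le_add_of_nonneg_right zero_le) hX.zero
  have := hind.map_add_eq_map_conv_map (hX.measurable s)
    ((hX.measurable (s + h)).sub (hX.measurable s))
  rw [show X (s + h) - X s = fun ω => X (s + h) ω - X s ω from rfl, hX.stationary] at this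
  rw [← this]
  congr 1
  ext ω
  simp

lemma IsLevyProcess.map_nat_mul (hX : IsLevyProcess X P) (h : ℝ≥0) (n : ℕ) :
    P.map (X (n * h)) = sumLaw (P.map (X h)) n := by
  have := hX.isProbabilityMeasure_map h
  induction n with
  | zero =>
    rw [sumLaw_zero, Nat.cast_zero, zero_mul, Measure.map_congr hX.zero, Measure.map_const]
    simp
  | succ n ih =>
    rw [sumLaw_succ, ← ih, ← hX.map_add]
    congr 2
    push_cast
    ring

/-- A normal approximation of the marginals, at a rate continuous in time, extends from a dense
set of times to all times by stochastic continuity. -/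
lemma IsLevyProcess.abs_cdf_sub_le_of_tendsto (hX : IsLevyProcess X P) {u : ℕ → ℝ≥0} {t : ℝ≥0}
    (ht : 0 < t) (hu : Tendsto u atTop (𝓝 t)) {μ σ K : ℝ} (hσ : 0 < σ)
    (hbound : ∀ᶠ k in atTop, ∀ x, |cdf (P.map (X (u k))) x -
      cdf (gaussianReal 0 1) ((x - u k * μ) / (σ * √(u k)))| ≤ K / √(u k)) (x : ℝ) :
    |cdf (P.map (X t)) x - cdf (gaussianReal 0 1) ((x - t * μ) / (σ * √t))| ≤ K / √t := by
  have hp : ∀ s, IsProbabilityMeasure (P.map (X s)) := hX.isProbabilityMeasure_map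
  set Φ := cdf (gaussianReal 0 1) with hΦ
  have hΦc : Continuous Φ := continuous_iff_continuousAt.mpr fun y =>
    (hasDerivAt_cdf_gaussianReal one_ne_zero y).continuousAt
  have hst : 0 < √(t : ℝ) := Real.sqrt_pos.mpr (by exact_mod_cast ht)
  have hu' : Tendsto (fun k => (u k : ℝ)) atTop (𝓝 t) := (NNReal.tendsto_coe).mpr hu
  have hsu : Tendsto (fun k => √(u k : ℝ)) atTop (𝓝 √t) := (Real.continuous_sqrt.tendsto _).comp hu'
  have hg : ∀ y, Tendsto (fun k => Φ ((y - u k * μ) / (σ * √(u k)))) atTop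
      (𝓝 (Φ ((y - t * μ) / (σ * √t)))) := fun y =>
    (hΦc.tendsto _).comp ((tendsto_const_nhds.sub (hu'.mul_const μ)).div (hsu.const_mul σ)
      (by positivity))
  have hK : Tendsto (fun k => K / √(u k : ℝ)) atTop (𝓝 (K / √t)) :=
    tendsto_const_nhds.div hsu hst.ne'
  have hΦd : Tendsto (fun δ : ℝ => Φ ((x + δ - t * μ) / (σ * √t))) (𝓝 0)
      (𝓝 (Φ ((x - t * μ) / (σ * √t)))) := by
    have : Continuous fun δ : ℝ => Φ ((x + δ - t * μ) / (σ * √t)) := by fun_prop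
    simpa using this.tendsto 0
  have herr : ∀ δ, 0 < δ → Tendsto (fun k => P.real {ω | δ ≤ ‖X (u k) ω - X t ω‖}) atTop (𝓝 0) :=
    fun δ hδ => ((tendstoInMeasure_iff_measureReal_norm.mp (hX.stochCont t)) δ hδ).comp hu
  -- shifting the argument by `δ` costs the probability of a difference of size at least `δ`
  have hcmp : ∀ (s r : ℝ≥0) (y δ : ℝ), cdf (P.map (X s)) y ≤
      cdf (P.map (X r)) (y + δ) + P.real {ω | δ ≤ ‖X s ω - X r ω‖} := by
    intro s r y δ
    rw [cdf_eq_real, cdf_eq_real, map_measureReal_apply (hX.measurable s) measurableSet_Iic,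
      map_measureReal_apply (hX.measurable r) measurableSet_Iic]
    refine (measureReal_mono ?_).trans (measureReal_union_le _ _)
    intro ω hω
    by_contra hcon
    simp only [Set.mem_union, Set.mem_preimage, Set.mem_Iic, Set.mem_ofPred_eq, not_or, not_le,
      Real.norm_eq_abs] at hcon hω
    linarith [(abs_lt.mp hcon.2).1]
  have hup : ∀ δ, 0 < δ → cdf (P.map (X t)) x ≤ Φ ((x + δ - t * μ) / (σ * √t)) + K / √t := by
    intro δ hδ
    have hlim := ((hg (x + δ)).add hK).add (herr δ hδ)
    rw [add_zero] at hlim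
    refine ge_of_tendsto hlim ?_
    filter_upwards [hbound] with k hk
    have h1 := hcmp t (u k) x δ
    have h2 := (abs_le.mp (hk (x + δ))).2
    simp_rw [norm_sub_rev (X t _)] at h1
    linarith
  have hlow : ∀ δ, 0 < δ → Φ ((x + -δ - t * μ) / (σ * √t)) - K / √t ≤ cdf (P.map (X t)) x := by
    intro δ hδ
    have hlim := ((hg (x + -δ)).sub hK).sub (herr δ hδ)
    rw [sub_zero] at hlim
    refine le_of_tendsto hlim ?_
    filter_upwards [hbound] with k hk
    have h1 := hcmp (u k) t (x + -δ) δ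
    have h2 := (abs_le.mp (hk (x + -δ))).1
    rw [neg_add_cancel_right] at h1
    linarith
  have hpos : Tendsto (fun δ : ℝ => δ) (𝓝[>] 0) (𝓝 0) := nhdsWithin_le_nhds
  have hneg : Tendsto (fun δ : ℝ => -δ) (𝓝[>] 0) (𝓝 0) := by
    simpa using hpos.neg
  rw [abs_le]
  constructor
  · have := le_of_tendsto ((hΦd.comp hneg).sub_const (K / √(t : ℝ)))
      (eventually_mem_nhdsWithin.mono fun δ hδ => hlow δ hδ)
    linarith
  · have := ge_of_tendsto ((hΦd.comp hpos).add_const (K / √(t : ℝ)))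
      (eventually_mem_nhdsWithin.mono fun δ hδ => hup δ hδ)
    linarith

end Levy

lemma cdf_gaussianReal_eq {m v : ℝ} (hv : 0 < v) (x : ℝ) :
    cdf (gaussianReal m v.toNNReal) x = cdf (gaussianReal 0 1) ((x - m) / √v) := by
  have hs : 0 < √v := Real.sqrt_pos.mpr hv
  rw [← cdf_map_const_mul (gaussianReal 0 1) hs, gaussianReal_map_const_mul,
    ← cdf_map_add_const _ m (√v * ((x - m) / √v)), gaussianReal_map_add_const]
  congr 1
  · congr 2
    · ring
    · ext
      rw [Real.coe_toNNReal _ hv.le]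
      simp [Real.sq_sqrt hv.le]
  · field_simp
    ring

/-- The marginals of a Brownian motion with drift are determined by the one at time `1`. -/
lemma IsBrownianMotion.map_eq {Ω : Type*} [MeasurableSpace Ω] {P : Measure Ω}
    {W : ℝ≥0 → Ω → ℝ} (hW : IsBrownianMotion W P) {μ v : ℝ} (hv : 0 ≤ v)
    (h1 : HasLaw (W 1) (gaussianReal μ v.toNNReal) P) (t : ℝ≥0) :
    P.map (W t) = gaussianReal (t * μ) (t * v).toNNReal := by
  obtain ⟨m, s, B, hB, hWB⟩ := hW
  have hlaw : ∀ r : ℝ≥0, P.map (W r) =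
      gaussianReal (m * r) (.mk (s ^ 2) (sq_nonneg _) * r) := by
    intro r
    have h := gaussianReal_const_add (gaussianReal_const_mul (hB.hasLaw_eval r) s) (m * r)
    rw [show W r = fun ω => m * r + s * B r ω from funext (hWB r), h.map_eq]
    simp
  have h := (hlaw 1).symm.trans h1.map_eq
  rw [gaussianReal_ext_iff] at h
  obtain ⟨e1, e2⟩ := h
  have e3 : s ^ 2 = v := by
    have := congrArg NNReal.toReal e2
    rw [Real.coe_toNNReal _ hv] at this
    simpa using this
  rw [hlaw t]
  simp only [NNReal.coe_one, mul_one] at e1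
  congr 1
  · rw [e1]; ring
  · ext
    rw [Real.coe_toNNReal _ (by positivity)]
    simp [e3, mul_comm]

section Main

variable {Ω : Type*} [MeasurableSpace Ω] {P : Measure Ω} [IsProbabilityMeasure P]
  {αp βp lp αm βm lm : ℝ} {X : ℝ≥0 → Ω → ℝ}

/-- Moments of the increments of a tempered stable process over an interval of length `1 / N`. -/
lemma IsTSProcess.moments (hαp : 0 < αp) (hβp : βp < 1) (hlp : 0 < lp) (hαm : 0 < αm)
    (hβm : βm < 1) (hlm : 0 < lm) (hX : IsTSProcess αp βp lp αm βm lm X P) {N : ℕ} (hN : 0 < N) :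
    MemLp id 4 (P.map (X (1 / N))) ∧
    ∫ x, x ∂(P.map (X (1 / N))) = (1 / N : ℝ) * (levyMoment αp βp lp 1 - levyMoment αm βm lm 1) ∧
    ∫ x, (x - ∫ y, y ∂(P.map (X (1 / N)))) ^ 2 ∂(P.map (X (1 / N))) =
      (1 / N : ℝ) * (levyMoment αp βp lp 2 + levyMoment αm βm lm 2) ∧
    (6 * levyMoment αp βp lp 2 ^ 3 ≤ N * levyMoment αp βp lp 3 ^ 2 →
      6 * levyMoment αm βm lm 2 ^ 3 ≤ N * levyMoment αm βm lm 3 ^ 2 →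
      ∫ x, |x - ∫ y, y ∂(P.map (X (1 / N)))| ^ 3 ∂(P.map (X (1 / N))) ≤
        16 * (1 / N : ℝ) * (levyMoment αp βp lp 3 + levyMoment αm βm lm 3)) := by
  obtain ⟨hL, hTS⟩ := hX
  have hp := hL.isProbabilityMeasure_map (1 / N)
  have hN0 : (N : ℝ≥0) ≠ 0 := by positivity
  have hsum : P.map (X 1) = sumLaw (P.map (X (1 / N))) N := by
    rw [← hL.map_nat_mul, mul_one_div_cancel hN0]
  rw [hsum] at hTS
  obtain ⟨h4, hv, h3⟩ := hTS.moments_of_root hαp hβp hlp hαm hβm hlm hN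
  refine ⟨h4, ?_, hv, h3⟩
  have h1 : MemLp id 1 (P.map (X (1 / N))) := h4.mono_exponent (by norm_num)
  have i1 : Integrable (fun x : ℝ => x) (P.map (X (1 / N))) := h1.integrable le_rfl
  have hcoord : ∀ i : Fin N, Integrable (fun y : Fin N → ℝ => y i)
      (Measure.pi fun _ : Fin N => P.map (X (1 / N))) := fun i =>
    (measurePreserving_eval (fun _ : Fin N => P.map (X (1 / N))) i).integrable_comp_of_integrable
      i1
  have hmean : ∫ x, x ∂(sumLaw (P.map (X (1 / N))) N) = N * ∫ x, x ∂(P.map (X (1 / N))) := by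
    rw [sumLaw, integral_map (by fun_prop) (by fun_prop : Continuous _).aestronglyMeasurable,
      integral_finsetSum _ fun i _ => hcoord i, Finset.sum_congr rfl fun i _ => ?_,
      Finset.sum_const, Finset.card_univ, Fintype.card_fin, nsmul_eq_mul]
    have h := (measurePreserving_eval (fun _ : Fin N => P.map (X (1 / N))) i).map_eq
    nth_rw 2 [← h]
    rw [integral_map (measurable_pi_apply i).aemeasurable
      (by fun_prop : Continuous _).aestronglyMeasurable]
  have hs1 : MemLp id 1 (sumLaw (P.map (X (1 / N))) N) := by
    rw [memLp_one_iff_integrable, sumLaw,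
      integrable_map_measure aestronglyMeasurable_id (by fun_prop)]
    exact integrable_finsetSum Finset.univ fun i _ => hcoord i
  have := hTS.integral_id hαp hβp hlp hαm hβm hlm hs1
  rw [hmean] at this
  rw [← this]
  have : (N : ℝ) ≠ 0 := by positivity
  field_simp

/-- The normal approximation at a rational time `p / q`: such a marginal is a sum of `p m`
independent increments over intervals of length `1 / (q m)`, for every `m`. -/
lemma IsTSProcess.abs_cdf_sub_le_of_rat (hαp : 0 < αp) (hβp : βp < 1) (hlp : 0 < lp)
    (hαm : 0 < αm) (hβm : βm < 1) (hlm : 0 < lm) (hX : IsTSProcess αp βp lp αm βm lm X P)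
    {μ σ : ℝ} (hμ : μ = levyMoment αp βp lp 1 - levyMoment αm βm lm 1) (hσ : 0 < σ)
    (hσ2 : σ ^ 2 = levyMoment αp βp lp 2 + levyMoment αm βm lm 2) {p q : ℕ} (hp : 0 < p)
    (hq : 0 < q) {t : ℝ≥0} (ht : t = p / q) (x : ℝ) :
    |cdf (P.map (X t)) x - cdf (gaussianReal 0 1) ((x - t * μ) / (σ * √t))| ≤
      32 * berryEsseenConstant *
        ((levyMoment αp βp lp 3 + levyMoment αm βm lm 3) / σ ^ 3) / √t := by
  have kp := levyMoment_pos hαp hβp hlp (k := 3) (by norm_num)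
  have km := levyMoment_pos hαm hβm hlm (k := 3) (by norm_num)
  -- the mesh is fine enough for the third moment bound
  obtain ⟨m, hm⟩ := exists_nat_ge (max (6 * levyMoment αp βp lp 2 ^ 3 / levyMoment αp βp lp 3 ^ 2)
    (max (6 * levyMoment αm βm lm 2 ^ 3 / levyMoment αm βm lm 3 ^ 2) 1))
  simp only [max_le_iff] at hm
  obtain ⟨hmp, hmm, hm1⟩ := hm
  have hm0 : 0 < m := by exact_mod_cast (lt_of_lt_of_le one_pos hm1)
  set N := q * m with hNdef
  have hN : 0 < N := Nat.mul_pos hq hm0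
  have hmN : (m : ℝ) ≤ N := by exact_mod_cast Nat.le_mul_of_pos_left m hq
  rw [div_le_iff₀ (by positivity)] at hmp hmm
  obtain ⟨h4, hmean, hvar, hthird⟩ := hX.moments hαp hβp hlp hαm hβm hlm hN
  have h3 := hthird (hmp.trans (by gcongr)) (hmm.trans (by gcongr))
  have hprob := hX.1.isProbabilityMeasure_map (1 / N)
  have hn : 0 < p * m := Nat.mul_pos hp hm0
  have hN0 : (0 : ℝ) < N := by exact_mod_cast hN
  have hvpos : 0 < (1 / N : ℝ) * (levyMoment αp βp lp 2 + levyMoment αm βm lm 2) := by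
    rw [← hσ2]; positivity
  rw [hmean] at hvar h3
  have hBE := abs_cdf_sumLaw_sub_gaussianReal_le (h4.mono_exponent (by norm_num)) hmean hvar
    hvpos hn x
  have htime : ((p * m : ℕ) : ℝ≥0) * (1 / N) = t := by
    have h1 : (m : ℝ≥0) ≠ 0 := by positivity
    have h2 : (q : ℝ≥0) ≠ 0 := by positivity
    rw [ht, hNdef]
    push_cast
    field_simp
  have htime' : ((p * m : ℕ) : ℝ) * (1 / N) = t := by
    have := congrArg NNReal.toReal htime
    simpa using this
  have ht0 : (0 : ℝ) < t := by
    rw [← htime']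
    have : (0 : ℝ) < (p * m : ℕ) := by exact_mod_cast hn
    positivity
  have hst : 0 < √(t : ℝ) := Real.sqrt_pos.mpr ht0
  rw [← hX.1.map_nat_mul, htime, ← mul_assoc, ← mul_assoc, htime', ← hμ, ← hσ2,
    cdf_gaussianReal_eq (by positivity), Real.sqrt_mul ht0.le, Real.sqrt_sq hσ.le,
    mul_comm (√(t : ℝ)) σ] at hBE
  refine hBE.trans ?_
  have hden : √((1 / N : ℝ) * σ ^ 2) ^ 3 * √((p * m : ℕ) : ℝ) = (1 / N : ℝ) * (σ ^ 3 * √t) := by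
    have hs : √(1 / N : ℝ) ^ 2 = 1 / N := Real.sq_sqrt (by positivity)
    have e : √(t : ℝ) = √((p * m : ℕ) : ℝ) * √(1 / N : ℝ) := by
      rw [← htime', Real.sqrt_mul (by positivity)]
    rw [Real.sqrt_mul (by positivity), Real.sqrt_sq hσ.le, e]
    nth_rw 2 [← hs]
    ring
  rw [hden]
  have hc := berryEsseenConstant_nonneg
  calc _ ≤ berryEsseenConstant * (16 * (1 / N : ℝ) *
        (levyMoment αp βp lp 3 + levyMoment αm βm lm 3)) / ((1 / N : ℝ) * (σ ^ 3 * √t)) := by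
        gcongr
        rw [hμ]
        exact h3
    _ = 16 * berryEsseenConstant *
        ((levyMoment αp βp lp 3 + levyMoment αm βm lm 3) / σ ^ 3) / √t := by
        field_simp
    _ ≤ _ := by
        gcongr
        norm_num

end Main

end TemperedStable

open TemperedStable in
theorem mainTheorem2
    {Ω Ω' : Type*} [MeasurableSpace Ω] [MeasurableSpace Ω']
    (P : Measure Ω) [IsProbabilityMeasure P] (P' : Measure Ω') [IsProbabilityMeasure P']
    (αp βp lp αm βm lm : ℝ)
    (hαp : 0 < αp) (hβp : 0 ≤ βp) (hβp' : βp < 1) (hlp : 0 < lp)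
    (hαm : 0 < αm) (hβm : 0 ≤ βm) (hβm' : βm < 1) (hlm : 0 < lm)
    (X : ℝ≥0 → Ω → ℝ) (hX : TemperedStable.IsTSProcess αp βp lp αm βm lm X P)
    (W : ℝ≥0 → Ω' → ℝ) (hW : TemperedStable.IsBrownianMotion W P')
    (μ σ : ℝ) (hμ : μ = ∫ ω, X 1 ω ∂P) (hσ : σ = √(variance (X 1) P))
    (hW1 : HasLaw (W 1) (gaussianReal μ (σ ^ 2).toNNReal) P') :
    MemLp (X 1) 2 P ∧ 0 < variance (X 1) P ∧
    (∀ t : ℝ≥0, 0 < t →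
      TemperedStable.kolmogorovDist (P.map (X t)) (P'.map (W t)) ≤
        TemperedStable.rateBound βp lp βm lm μ σ t) ∧
    Tendsto (fun t : ℝ≥0 => TemperedStable.rateBound βp lp βm lm μ σ t) atTop (𝓝 0) ∧
    Tendsto (fun t : ℝ≥0 => TemperedStable.kolmogorovDist (P.map (X t)) (P'.map (W t)))
      atTop (𝓝 0) := by
  have hmeas : Measurable (X 1) := hX.1.measurable 1
  have hprob := hX.1.isProbabilityMeasure_map 1
  obtain ⟨h4, hmean, hvar, -⟩ := hX.moments hαp hβp' hlp hαm hβm' hlm one_pos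
  simp only [Nat.cast_one, div_one, one_mul] at h4 hmean hvar
  have hL2 : MemLp (X 1) 2 P := by
    have : MemLp id 2 (P.map (X 1)) := h4.mono_exponent (by norm_num)
    rwa [memLp_map_measure_iff aestronglyMeasurable_id hmeas.aemeasurable] at this
  have hμ' : ∫ y, y ∂(P.map (X 1)) = μ := by
    rw [hμ, integral_map hmeas.aemeasurable (by fun_prop : Continuous _).aestronglyMeasurable]
  have hVar : variance (X 1) P = levyMoment αp βp lp 2 + levyMoment αm βm lm 2 := by
    rw [← hvar, variance_eq_integral hmeas.aemeasurable, hμ',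
      integral_map hmeas.aemeasurable (by fun_prop : Continuous _).aestronglyMeasurable, ← hμ]
  have hV0 : 0 < variance (X 1) P := by
    rw [hVar]
    exact add_pos (levyMoment_pos hαp hβp' hlp (by norm_num))
      (levyMoment_pos hαm hβm' hlm (by norm_num))
  have hσ0 : 0 < σ := by
    rw [hσ]
    exact Real.sqrt_pos.mpr hV0
  have hσ2 : σ ^ 2 = levyMoment αp βp lp 2 + levyMoment αm βm lm 2 := by
    rw [hσ, Real.sq_sqrt hV0.le, hVar]
  have hμ2 : μ = levyMoment αp βp lp 1 - levyMoment αm βm lm 1 := by rw [← hμ', hmean]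
  have hrate := rateBound_eq hαp hβp' hlp hαm hβm' hlm hμ2 hσ0 hσ2
  have hbound : ∀ t : ℝ≥0, 0 < t → kolmogorovDist (P.map (X t)) (P'.map (W t)) ≤
      rateBound βp lp βm lm μ σ t := by
    intro t ht
    have ht' : (0 : ℝ) < t := by exact_mod_cast ht
    refine ciSup_le fun x => ?_
    rw [hW.map_eq (sq_nonneg σ) hW1, cdf_gaussianReal_eq (by positivity), hrate,
      Real.sqrt_mul ht'.le, Real.sqrt_sq hσ0.le, mul_comm (√(t : ℝ)) σ]
    have hu : Tendsto (fun k : ℕ => (⌈(t : ℝ) * k⌉₊ : ℝ≥0) / k) atTop (𝓝 t) := by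
      refine NNReal.tendsto_coe.mp ?_
      refine ((tendsto_nat_ceil_mul_div_atTop ht'.le).comp tendsto_natCast_atTop_atTop).congr
        fun k => ?_
      simp
    refine hX.1.abs_cdf_sub_le_of_tendsto ht hu hσ0 ?_ x
    filter_upwards [eventually_gt_atTop 0] with k hk y
    have hk' : (0 : ℝ) < k := by exact_mod_cast hk
    exact hX.abs_cdf_sub_le_of_rat hαp hβp' hlp hαm hβm' hlm hμ2 hσ0 hσ2
      (Nat.ceil_pos.mpr (mul_pos ht' hk')) hk rfl y
  have hzero : Tendsto (fun t : ℝ≥0 => rateBound βp lp βm lm μ σ t) atTop (𝓝 0) := by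
    simp_rw [hrate]
    have hs : Tendsto (fun t : ℝ≥0 => √(t : ℝ)) atTop atTop :=
      Real.tendsto_sqrt_atTop.comp (NNReal.tendsto_coe_atTop.mpr tendsto_id)
    exact hs.const_div_atTop _
  refine ⟨hL2, hV0, hbound, hzero, ?_⟩
  refine squeeze_zero' (.of_forall fun t => kolmogorovDist_nonneg _ _) ?_ hzero
  filter_upwards [eventually_gt_atTop 0] with t ht using hbound t ht
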